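/- Let $d\mu(z)=e^{-|z|^2}\,dx\,dy$ on $\mathbb C$, and let $L^2(\mu)=L^2(\mathbb C,d\mu)$ be the complex Hilbert space with $\langle f,g\rangle=\int f\bar g\,d\mu$. Write $\partial_z=\frac12(\partial_x-i\partial_y)$, $\partial_{\bar z}=\frac12(\partial_x+i\partial_y)$, and let $$\mathcal C f(z)=\frac1\pi\int_{\mathbb C}\frac{f(\xi)}{z-\xi}\,d\mu(\xi)$$ be the weighted Cauchy transform, a linear operator on $L^2(\mu)$. For integers $m,n\ge 0$ let $$H_{m,n}(z)=(-1)^{m+n}e^{|z|^2}\partial_{\bar z}^{\,m}\partial_z^{\,n}\big(e^{-|z|^2}\big)$$ be the Itô–Hermite polynomials (leading term $z^m\bar z^n$). Let $\mathcal A^2_n=\ker(\Delta-n)\subset L^2(\mu)$ be the $L^2$-eigenspace, for the eigenvalue $n$, of the Landau operator $\Delta=(-\partial_z+\bar z)\partial_{\bar z}$ (the equation $\Delta f=nf$ being understood in the weak sense, against $C_c^\infty$ test functions), let $P_n$ be the orthogonal projection of $L^2(\mu)$ onto $\mathcal A^2_n$, and let $\widetilde{\mathcal A}^2_\ell$ be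 the closed linear span in $L^2(\mu)$ of $\{H_{\ell,n}: n=0,1,2,\dots\}$. For $\ell,n\ge0$ put $R^\ell_n=P_n\mathcal C(\mathcal A^2_\ell)$ and $\widetilde R^\ell_n=P_n\mathcal C(\widetilde{\mathcal A}^2_\ell)$. **Theorem.** (i) For all integers $\ell,n\ge 0$, $R^\ell_n$ is an infinite-dimensional vector space, spanned (in the Hilbert space sense) by the functions $H_{n+j-\ell-1,n}$, $j\ge\max(0,\ell+1-n)$: all these functions belong to $R^\ell_n$, and the closure of $R^\ell_n$ in $L^2(\mu)$ is their closed linear span. More precisely, $R^\ell_n$ is exactly the set of sums of the $L^2(\mu)$-convergent series $$\sum_{j\ge\max(0,\ell+1-n)}\frac{(n+j-1)!}{2^{j}\,(n+j-\ell-1)!}\,\alpha_j\,H_{n+j-\ell-1,n},\qquad \alpha_j\in\mathbb C,\quad \sum_{j\ge0} j!\,|\alpha_j|^2<\infty .$$ (ii) $\widetilde R^0_0=\{0\}$. (iii) For $\ell+n>0$, $\widetilde R^\ell_n$ is a finite-dimensional vector space of dimension $n+\ell$, and $H_{k,n}$, $k=0,1,\dots,n+\ell-1$, is an orthogonal basis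 of it. -/

import Mathlib

open MeasureTheory

open scoped ComplexConjugate ENNReal ContDiff

noncomputable section

namespace WeightedCauchy

/-! ### The Gaussian Hilbert space -/

/-- The Gaussian measure `exp (-|z|^2) dx dy` on the complex plane. -/
def gaussMeasure : Measure ℂ :=
  (volume : Measure ℂ).withDensity fun z => ENNReal.ofReal (Real.exp (-‖z‖ ^ 2))

/-- The Hilbert space `L^2(ℂ, exp (-|z|^2) dx dy)`. -/
abbrev GaussL2 : Type := Lp ℂ 2 gaussMeasure

/-! ### Wirtinger derivatives, the Landau operator and the Ito-Hermite polynomials -/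

/-- `∂/∂z = (∂/∂x - i ∂/∂y) / 2`. -/
def dz (f : ℂ → ℂ) (z : ℂ) : ℂ :=
  (1 / 2) * (fderiv ℝ f z 1 - Complex.I * fderiv ℝ f z Complex.I)

/-- `∂/∂z̄ = (∂/∂x + i ∂/∂y) / 2`. -/
def dzbar (f : ℂ → ℂ) (z : ℂ) : ℂ :=
  (1 / 2) * (fderiv ℝ f z 1 + Complex.I * fderiv ℝ f z Complex.I)

/-- The Landau operator `Δ = (-∂_z + z̄) ∂_z̄`. -/
def landau (f : ℂ → ℂ) (z : ℂ) : ℂ :=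
  -dz (dzbar f) z + conj z * dzbar f z

/-- The Gaussian `exp (-|z|^2)` as a complex valued function. -/
def gauss (z : ℂ) : ℂ := (Real.exp (-‖z‖ ^ 2) : ℂ)

/-- The Ito-Hermite polynomials, by the Rodrigues formula
`H_{m,n} = (-1)^(m+n) exp (|z|^2) ∂_z̄^m ∂_z^n exp (-|z|^2)`; the leading term is `z^m z̄^n`. -/
def itoHermite (m n : ℕ) (z : ℂ) : ℂ :=
  (-1) ^ (m + n) * (Real.exp (‖z‖ ^ 2) : ℂ) * (dzbar^[m] (dz^[n] gauss)) z

/-! ### The Ito-Hermite polynomials are square integrable -/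

theorem gauss_eq (z : ℂ) : gauss z = Complex.exp (-(z * conj z)) := by
  simp [gauss, Complex.mul_conj, Complex.normSq_eq_norm_sq]

theorem gauss_differentiable : Differentiable ℝ gauss := by
  have h : gauss = fun z : ℂ => Complex.exp (-(z * conj z)) := funext gauss_eq
  rw [h]
  have hc : Differentiable ℝ (fun z : ℂ => conj z) := Complex.conjCLE.differentiable
  fun_prop

theorem fderiv_gauss (z v : ℂ) :
    fderiv ℝ gauss z v = -(v * conj z + z * conj v) * gauss z := by
  have h : gauss = fun z : ℂ => Complex.exp (-(z * conj z)) := funext gauss_eq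
  have hc : HasFDerivAt (fun z : ℂ => conj z) (Complex.conjCLE : ℂ →L[ℝ] ℂ) z :=
    Complex.conjCLE.hasFDerivAt
  have h2 := (((hasFDerivAt_id (𝕜 := ℝ) z).mul hc).neg).cexp
  rw [h]
  have h3 := congrArg (fun L : ℂ →L[ℝ] ℂ => L v) h2.fderiv
  refine Eq.trans h3 ?_
  simp
  ring

theorem conj_differentiable : Differentiable ℝ (fun z : ℂ => conj z) :=
  Complex.conjCLE.differentiable

theorem fderiv_monomial (a b : ℕ) (z v : ℂ) :
    fderiv ℝ (fun z : ℂ => z ^ a * conj z ^ b * gauss z) z v =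
      (a * z ^ (a - 1) * v * conj z ^ b + z ^ a * (b * conj z ^ (b - 1) * conj v)
        - z ^ a * conj z ^ b * (v * conj z + z * conj v)) * gauss z := by
  have hc : HasFDerivAt (fun z : ℂ => conj z) (Complex.conjCLE : ℂ →L[ℝ] ℂ) z :=
    Complex.conjCLE.hasFDerivAt
  have h2 := (((hasFDerivAt_id (𝕜 := ℝ) z).pow a).mul (hc.pow b)).mul
    (gauss_differentiable z).hasFDerivAt
  have h3 := congrArg (fun L : ℂ →L[ℝ] ℂ => L v) h2.fderiv
  refine Eq.trans h3 ?_
  simp [fderiv_gauss]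
  ring

/-- The linear span of the functions `z^a z̄^b exp (-|z|^2)`. -/
def polyGauss : Submodule ℂ (ℂ → ℂ) :=
  Submodule.span ℂ (Set.range fun p : ℕ × ℕ => fun z : ℂ => z ^ p.1 * conj z ^ p.2 * gauss z)

theorem monomial_mem (a b : ℕ) :
    (fun z : ℂ => z ^ a * conj z ^ b * gauss z) ∈ polyGauss :=
  Submodule.subset_span ⟨(a, b), rfl⟩

theorem polyGauss_deriv {f : ℂ → ℂ} (hf : f ∈ polyGauss) :
    Differentiable ℝ f ∧ dz f ∈ polyGauss ∧ dzbar f ∈ polyGauss := by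
  refine Submodule.span_induction (p := fun f _ => Differentiable ℝ f ∧ dz f ∈ polyGauss ∧
    dzbar f ∈ polyGauss) ?_ ?_ ?_ ?_ hf
  · rintro _ ⟨⟨a, b⟩, rfl⟩
    refine ⟨?_, ?_, ?_⟩
    · have := gauss_differentiable
      have := conj_differentiable
      fun_prop
    · have h : dz (fun z : ℂ => z ^ a * conj z ^ b * gauss z) =
          (a : ℂ) • (fun z : ℂ => z ^ (a - 1) * conj z ^ b * gauss z)
            - (fun z : ℂ => z ^ a * conj z ^ (b + 1) * gauss z) := by
        funext z
        simp only [dz, fderiv_monomial, Pi.sub_apply, Pi.smul_apply, smul_eq_mul]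
        simp only [map_one, Complex.conj_I]
        ring_nf
        simp only [Complex.I_sq]
        ring
      simp only
      rw [h]
      exact polyGauss.sub_mem (polyGauss.smul_mem _ (monomial_mem _ _)) (monomial_mem _ _)
    · have h : dzbar (fun z : ℂ => z ^ a * conj z ^ b * gauss z) =
          (b : ℂ) • (fun z : ℂ => z ^ a * conj z ^ (b - 1) * gauss z)
            - (fun z : ℂ => z ^ (a + 1) * conj z ^ b * gauss z) := by
        funext z
        simp only [dzbar, fderiv_monomial, Pi.sub_apply, Pi.smul_apply, smul_eq_mul]
        simp only [map_one, Complex.conj_I]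
        ring_nf
        simp only [Complex.I_sq]
        ring
      simp only
      rw [h]
      exact polyGauss.sub_mem (polyGauss.smul_mem _ (monomial_mem _ _)) (monomial_mem _ _)
  · refine ⟨differentiable_const 0, ?_, ?_⟩
    · have h : dz 0 = 0 := by funext z; simp [dz]
      rw [h]; exact polyGauss.zero_mem
    · have h : dzbar 0 = 0 := by funext z; simp [dzbar]
      rw [h]; exact polyGauss.zero_mem
  · rintro f g - - ⟨hf, hf1, hf2⟩ ⟨hg, hg1, hg2⟩
    refine ⟨hf.add hg, ?_, ?_⟩
    · have h : dz (f + g) = dz f + dz g := by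
        funext z
        simp only [dz, fderiv_add (hf z) (hg z), _root_.add_apply, Pi.add_apply]
        ring
      rw [h]; exact polyGauss.add_mem hf1 hg1
    · have h : dzbar (f + g) = dzbar f + dzbar g := by
        funext z
        simp only [dzbar, fderiv_add (hf z) (hg z), _root_.add_apply, Pi.add_apply]
        ring
      rw [h]; exact polyGauss.add_mem hf2 hg2
  · rintro c f - ⟨hf, hf1, hf2⟩
    refine ⟨hf.const_smul c, ?_, ?_⟩
    · have h : dz (c • f) = c • dz f := by
        funext z
        simp only [dz, fderiv_const_smul (hf z), _root_.smul_apply, Pi.smul_apply,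
          smul_eq_mul]
        ring
      rw [h]; exact polyGauss.smul_mem _ hf1
    · have h : dzbar (c • f) = c • dzbar f := by
        funext z
        simp only [dzbar, fderiv_const_smul (hf z), _root_.smul_apply, Pi.smul_apply,
          smul_eq_mul]
        ring
      rw [h]; exact polyGauss.smul_mem _ hf2

theorem iterate_mem (m n : ℕ) : dzbar^[m] (dz^[n] gauss) ∈ polyGauss := by
  have h0 : gauss ∈ polyGauss := by simpa using monomial_mem 0 0
  have h1 : dz^[n] gauss ∈ polyGauss := by
    induction n with
    | zero => exact h0
    | succ k ih =>
      rw [Function.iterate_succ_apply']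
      exact (polyGauss_deriv ih).2.1
  induction m with
  | zero => exact h1
  | succ k ih =>
    rw [Function.iterate_succ_apply']
    exact (polyGauss_deriv ih).2.2

theorem measurable_density :
    Measurable fun z : ℂ => ENNReal.ofReal (Real.exp (-‖z‖ ^ 2)) := by fun_prop

theorem integrable_gauss_iff {f : ℂ → ℝ} :
    Integrable f gaussMeasure ↔ Integrable fun z => Real.exp (-‖z‖ ^ 2) * f z := by
  rw [gaussMeasure, integrable_withDensity_iff_integrable_smul' measurable_density
    (Filter.Eventually.of_forall fun _ => ENNReal.ofReal_lt_top)]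
  simp only [ENNReal.toReal_ofReal (Real.exp_pos _).le, smul_eq_mul]

theorem integrable_norm_rpow {q : ℝ} (hq : -2 < q) :
    Integrable (fun z : ℂ => ‖z‖ ^ q) gaussMeasure := by
  rw [integrable_gauss_iff]
  have h := Complex.integral_rpow_mul_exp_neg_rpow (p := 2) (q := q) (by norm_num) hq
  have h2 : Integrable fun z : ℂ => ‖z‖ ^ q * Real.exp (-‖z‖ ^ (2 : ℝ)) := by
    refine Integrable.of_integral_ne_zero ?_
    rw [h]
    have : 0 < Real.Gamma ((q + 2) / 2) := Real.Gamma_pos_of_pos (by linarith)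
    have := Real.pi_pos
    positivity
  refine h2.congr (Filter.Eventually.of_forall fun z => ?_)
  simp [mul_comm]

instance : IsFiniteMeasure gaussMeasure := by
  have h := integrable_norm_rpow (q := 0) (by norm_num)
  simp only [Real.rpow_zero] at h
  have h2 := integrable_const_iff.1 h
  simpa using h2

theorem memLp_monomial (a b : ℕ) :
    MemLp (fun z : ℂ => z ^ a * conj z ^ b) 2 gaussMeasure := by
  have hm : Continuous (fun z : ℂ => z ^ a * conj z ^ b) := by fun_prop
  rw [memLp_two_iff_integrable_sq_norm hm.aestronglyMeasurable]
  have h := integrable_norm_rpow (q := ((a + b) * 2 : ℕ)) (by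
    have : (0 : ℝ) ≤ ((a + b) * 2 : ℕ) := Nat.cast_nonneg _
    linarith)
  refine h.congr (Filter.Eventually.of_forall fun z => ?_)
  simp only [Real.rpow_natCast, norm_mul, norm_pow, RCLike.norm_conj]
  ring

theorem memLp_of_mem_polyGauss {f : ℂ → ℂ} (hf : f ∈ polyGauss) :
    MemLp (fun z : ℂ => (Real.exp (‖z‖ ^ 2) : ℂ) * f z) 2 gaussMeasure := by
  induction hf using Submodule.span_induction with
  | mem f h =>
    obtain ⟨⟨a, b⟩, rfl⟩ := h
    convert memLp_monomial a b using 2 with z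
    have h1 : (Real.exp (‖z‖ ^ 2) : ℂ) * gauss z = 1 := by
      rw [gauss, ← Complex.ofReal_mul, ← Real.exp_add]
      simp
    linear_combination (z ^ a * conj z ^ b) * h1
  | zero => simp
  | add f g _ _ h1 h2 =>
    convert h1.add h2 using 1
    funext z
    simp only [Pi.add_apply]
    ring
  | smul c f _ h1 =>
    convert h1.const_mul c using 1
    funext z
    simp only [Pi.smul_apply, smul_eq_mul]
    ring

theorem itoHermite_memLp (m n : ℕ) : MemLp (itoHermite m n) 2 gaussMeasure := by
  convert (memLp_of_mem_polyGauss (iterate_mem m n)).const_mul ((-1 : ℂ) ^ (m + n)) using 1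
  funext z
  simp only [itoHermite]
  ring

/-- `H_{m,n}` as an element of the Gaussian Hilbert space. -/
def hermiteVec (m n : ℕ) : GaussL2 := (itoHermite_memLp m n).toLp

/-! ### The weighted Cauchy transform -/

/-- The weighted Cauchy transform `(1/π) ∫ f(ξ) / (z - ξ) dμ(ξ)` of a function. -/
def cauchyIntegral (f : ℂ → ℂ) (z : ℂ) : ℂ :=
  (1 / (Real.pi : ℂ)) * ∫ ξ, f ξ / (z - ξ) ∂gaussMeasure

/-- The bound for the integrals of the Cauchy kernel. -/
def kernelBound : ℝ≥0∞ :=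
  gaussMeasure Set.univ + ∫⁻ z : ℂ, ENNReal.ofReal (Real.exp 1) * ‖(‖z‖ ^ (-1 : ℝ))‖ₑ ∂gaussMeasure

theorem kernelBound_lt_top : kernelBound < ⊤ := by
  have h := (integrable_norm_rpow (q := -1) (by norm_num)).2
  refine ENNReal.add_lt_top.2 ⟨measure_lt_top _ _, ?_⟩
  rw [lintegral_const_mul' _ _ ENNReal.ofReal_ne_top]
  exact ENNReal.mul_lt_top ENNReal.ofReal_lt_top h

theorem lintegral_kernel_le (z : ℂ) : ∫⁻ ξ, ‖(z - ξ)⁻¹‖ₑ ∂gaussMeasure ≤ kernelBound := by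
  let k : ℂ → ℝ≥0∞ := (Metric.ball (0 : ℂ) 1).indicator fun w => ‖w⁻¹‖ₑ
  have hk : Measurable k := by
    refine Measurable.indicator ?_ Metric.isOpen_ball.measurableSet
    fun_prop
  have h1 : ∀ ξ : ℂ, ‖(z - ξ)⁻¹‖ₑ ≤ 1 + k (z - ξ) := by
    intro ξ
    by_cases h : z - ξ ∈ Metric.ball (0 : ℂ) 1
    · simp only [k, Set.indicator_of_mem h]
      exact le_add_self
    · refine le_trans ?_ le_self_add
      have h2 : 1 ≤ ‖z - ξ‖ := by simpa using h
      rw [← ofReal_norm, norm_inv]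
      exact ENNReal.ofReal_le_one.2 (inv_le_one_of_one_le₀ h2)
  have h2 : ∫⁻ ξ, k (z - ξ) ∂gaussMeasure ≤ ∫⁻ w, k w := by
    rw [gaussMeasure, lintegral_withDensity_eq_lintegral_mul _ measurable_density
      (by fun_prop)]
    calc _ ≤ ∫⁻ ξ, k (z - ξ) := by
          refine lintegral_mono fun ξ => ?_
          refine mul_le_of_le_one_left zero_le ?_
          refine ENNReal.ofReal_le_one.2 ?_
          rw [Real.exp_le_one_iff]
          nlinarith [sq_nonneg ‖ξ‖]
      _ = _ := lintegral_sub_left_eq_self k z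
  have h3 : ∫⁻ w, k w ≤
      ∫⁻ w : ℂ, ENNReal.ofReal (Real.exp 1) * ‖(‖w‖ ^ (-1 : ℝ))‖ₑ ∂gaussMeasure := by
    rw [gaussMeasure, lintegral_withDensity_eq_lintegral_mul _ measurable_density
      (by fun_prop)]
    refine lintegral_mono fun w => ?_
    by_cases h : w ∈ Metric.ball (0 : ℂ) 1
    · simp only [k, Set.indicator_of_mem h, Pi.mul_apply]
      have h4 : ‖w⁻¹‖ₑ = ‖(‖w‖ ^ (-1 : ℝ))‖ₑ := by
        rw [Real.rpow_neg_one, ← ofReal_norm, ← ofReal_norm, norm_inv]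
        simp
      rw [h4, ← mul_assoc]
      refine le_mul_of_one_le_left zero_le ?_
      rw [← ENNReal.ofReal_mul (Real.exp_pos _).le, ← Real.exp_add]
      refine ENNReal.one_le_ofReal.2 ?_
      rw [Real.one_le_exp_iff]
      have h5 : ‖w‖ < 1 := by simpa using h
      nlinarith [norm_nonneg w]
    · simp only [k, Set.indicator_of_notMem h]
      exact zero_le
  calc _ ≤ ∫⁻ ξ, (1 + k (z - ξ)) ∂gaussMeasure := lintegral_mono h1
    _ = gaussMeasure Set.univ + ∫⁻ ξ, k (z - ξ) ∂gaussMeasure := by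
      rw [lintegral_add_left measurable_const, lintegral_one]
    _ ≤ _ := add_le_add le_rfl (h2.trans h3)

theorem lintegral_cauchy_sq_le {f : ℂ → ℂ} (hf : StronglyMeasurable f) :
    ∫⁻ z, (∫⁻ ξ, ‖f ξ / (z - ξ)‖ₑ ∂gaussMeasure) ^ (2 : ℝ) ∂gaussMeasure ≤
      kernelBound ^ 2 * ∫⁻ ξ, ‖f ξ‖ₑ ^ (2 : ℝ) ∂gaussMeasure := by
  have hfm : Measurable fun ξ => ‖f ξ‖ₑ := hf.enorm
  have hholder : ∀ z, (∫⁻ ξ, ‖f ξ / (z - ξ)‖ₑ ∂gaussMeasure) ^ (2 : ℝ) ≤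
      kernelBound * ∫⁻ ξ, ‖f ξ‖ₑ ^ (2 : ℝ) * ‖(z - ξ)⁻¹‖ₑ ∂gaussMeasure := by
    intro z
    have hkm : Measurable fun ξ : ℂ => ‖(z - ξ)⁻¹‖ₑ := by fun_prop
    have hh := ENNReal.lintegral_mul_le_Lp_mul_Lq gaussMeasure Real.HolderConjugate.two_two
      (f := fun ξ => ‖f ξ‖ₑ * ‖(z - ξ)⁻¹‖ₑ ^ (1 / 2 : ℝ))
      (g := fun ξ => ‖(z - ξ)⁻¹‖ₑ ^ (1 / 2 : ℝ))
      (hfm.mul (hkm.pow_const _)).aemeasurable (hkm.pow_const _).aemeasurable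
    have e1 : ∀ x : ℝ≥0∞, (x ^ (1 / 2 : ℝ)) ^ (2 : ℝ) = x := by
      intro x
      rw [← ENNReal.rpow_mul]
      norm_num
    have e2 : ∀ x : ℝ≥0∞, x ^ (1 / 2 : ℝ) * x ^ (1 / 2 : ℝ) = x := by
      intro x
      rw [← ENNReal.rpow_add_of_nonneg _ _ (by norm_num) (by norm_num)]
      norm_num
    simp only [Pi.mul_apply, mul_assoc, e2, ENNReal.mul_rpow_of_nonneg _ _ zero_le_two, e1] at hh
    have h3 := ENNReal.rpow_le_rpow hh zero_le_two
    rw [ENNReal.mul_rpow_of_nonneg _ _ zero_le_two, e1, e1, mul_comm] at h3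
    simp only [div_eq_mul_inv, enorm_mul]
    exact h3.trans (mul_le_mul' (lintegral_kernel_le z) le_rfl)
  calc _ ≤ ∫⁻ z, kernelBound * ∫⁻ ξ, ‖f ξ‖ₑ ^ (2 : ℝ) * ‖(z - ξ)⁻¹‖ₑ ∂gaussMeasure ∂gaussMeasure :=
        lintegral_mono hholder
    _ = kernelBound *
        ∫⁻ z, ∫⁻ ξ, ‖f ξ‖ₑ ^ (2 : ℝ) * ‖(z - ξ)⁻¹‖ₑ ∂gaussMeasure ∂gaussMeasure :=
      lintegral_const_mul' _ _ kernelBound_lt_top.ne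
    _ = kernelBound *
        ∫⁻ ξ, ∫⁻ z, ‖f ξ‖ₑ ^ (2 : ℝ) * ‖(z - ξ)⁻¹‖ₑ ∂gaussMeasure ∂gaussMeasure := by
      rw [lintegral_lintegral_swap]
      refine Measurable.aemeasurable ?_
      have : Measurable fun p : ℂ × ℂ => ‖f p.2‖ₑ := hfm.comp measurable_snd
      simp only [Function.uncurry_def]
      fun_prop
    _ ≤ kernelBound * ∫⁻ ξ, kernelBound * ‖f ξ‖ₑ ^ (2 : ℝ) ∂gaussMeasure := by
      refine mul_le_mul' le_rfl (lintegral_mono fun ξ => ?_)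
      simp only
      rw [lintegral_const_mul _ (by fun_prop), mul_comm]
      refine mul_le_mul' ?_ le_rfl
      have hs : ∀ z : ℂ, ‖(z - ξ)⁻¹‖ₑ = ‖(ξ - z)⁻¹‖ₑ := by
        intro z
        rw [← neg_sub ξ z, inv_neg, enorm_neg]
      simp only [hs]
      exact lintegral_kernel_le ξ
    _ = _ := by
      rw [lintegral_const_mul' _ _ kernelBound_lt_top.ne, ← mul_assoc, sq]

theorem ae_integrable_cauchy {f : ℂ → ℂ} (hf : StronglyMeasurable f)
    (h2 : MemLp f 2 gaussMeasure) :
    ∀ᵐ z ∂gaussMeasure, Integrable (fun ξ => f ξ / (z - ξ)) gaussMeasure := by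
  have hfm : Measurable f := hf.measurable
  have hjoint : Measurable fun p : ℂ × ℂ => ‖f p.2 / (p.1 - p.2)‖ₑ := by
    have : Measurable fun p : ℂ × ℂ => f p.2 := hfm.comp measurable_snd
    fun_prop
  have hfin : ∫⁻ ξ, ‖f ξ‖ₑ ^ (2 : ℝ) ∂gaussMeasure < ⊤ := by
    simpa using (eLpNorm_lt_top_iff_lintegral_rpow_enorm_lt_top two_ne_zero
      ENNReal.ofNat_ne_top).1 h2.2
  have hlt := (lintegral_cauchy_sq_le hf).trans_lt
    (ENNReal.mul_lt_top (ENNReal.pow_lt_top kernelBound_lt_top) hfin)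
  have hm := hjoint.lintegral_prod_right' (ν := gaussMeasure)
  filter_upwards [ae_lt_top (hm.pow_const _) hlt.ne] with z hz
  refine ⟨?_, ?_⟩
  · have : Measurable fun ξ => f ξ / (z - ξ) := by fun_prop
    exact this.aestronglyMeasurable
  · exact (ENNReal.rpow_lt_top_iff_of_pos zero_lt_two).1 hz

theorem cauchyIntegral_memLp {f : ℂ → ℂ} (hf : StronglyMeasurable f)
    (h2 : MemLp f 2 gaussMeasure) : MemLp (cauchyIntegral f) 2 gaussMeasure := by
  have hfm : Measurable f := hf.measurable
  have hjoint : StronglyMeasurable fun p : ℂ × ℂ => f p.2 / (p.1 - p.2) := by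
    have : Measurable fun p : ℂ × ℂ => f p.2 := hfm.comp measurable_snd
    exact Measurable.stronglyMeasurable (by fun_prop)
  have hmeas : StronglyMeasurable fun z => ∫ ξ, f ξ / (z - ξ) ∂gaussMeasure :=
    hjoint.integral_prod_right' (ν := gaussMeasure)
  refine MemLp.const_mul (f := fun z => ∫ ξ, f ξ / (z - ξ) ∂gaussMeasure)
    ⟨hmeas.aestronglyMeasurable, ?_⟩ _
  rw [eLpNorm_lt_top_iff_lintegral_rpow_enorm_lt_top two_ne_zero ENNReal.ofNat_ne_top]
  have hfin : ∫⁻ ξ, ‖f ξ‖ₑ ^ (2 : ℝ) ∂gaussMeasure < ⊤ := by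
    simpa using (eLpNorm_lt_top_iff_lintegral_rpow_enorm_lt_top two_ne_zero
      ENNReal.ofNat_ne_top).1 h2.2
  have hlt := (lintegral_cauchy_sq_le hf).trans_lt
    (ENNReal.mul_lt_top (ENNReal.pow_lt_top kernelBound_lt_top) hfin)
  refine lt_of_le_of_lt (lintegral_mono fun z => ?_) hlt
  simp only [ENNReal.toReal_ofNat]
  exact ENNReal.rpow_le_rpow
    (enorm_integral_le_lintegral_enorm (fun ξ => f ξ / (z - ξ))) zero_le_two

/-- The weighted Cauchy transform as a linear operator on the Gaussian Hilbert space. -/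
def cauchyTransform : GaussL2 →ₗ[ℂ] GaussL2 where
  toFun f := (cauchyIntegral_memLp (Lp.stronglyMeasurable f) (Lp.memLp f)).toLp
  map_add' f g := by
    rw [← MemLp.toLp_add]
    refine MemLp.toLp_congr _ _ ?_
    filter_upwards [ae_integrable_cauchy (Lp.stronglyMeasurable f) (Lp.memLp f),
      ae_integrable_cauchy (Lp.stronglyMeasurable g) (Lp.memLp g)] with z hf hg
    simp only [cauchyIntegral, Pi.add_apply]
    rw [← mul_add, ← integral_add hf hg]
    congr 1
    refine integral_congr_ae ?_
    filter_upwards [Lp.coeFn_add f g] with ξ h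
    rw [h, Pi.add_apply, add_div]
  map_smul' c f := by
    rw [RingHom.id_apply, ← MemLp.toLp_const_smul]
    refine MemLp.toLp_congr _ _ (Filter.Eventually.of_forall fun z => ?_)
    simp only [cauchyIntegral, Pi.smul_apply, smul_eq_mul]
    rw [mul_left_comm, ← integral_const_mul c]
    congr 1
    refine integral_congr_ae ?_
    filter_upwards [Lp.coeFn_smul c f] with ξ h
    rw [h, Pi.smul_apply, smul_eq_mul, mul_div_assoc]

/-! ### The true poly-Bargmann spaces and their orthogonal projections -/

theorem landau_sub_memLp (n : ℕ) {φ : ℂ → ℂ} (hφ : ContDiff ℝ ∞ φ) (hc : HasCompactSupport φ) :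
    MemLp (fun z => landau φ z - n * φ z) 2 gaussMeasure := by
  have key : ∀ ψ : ℂ → ℂ, ContDiff ℝ ∞ ψ → HasCompactSupport ψ →
      (ContDiff ℝ ∞ (dz ψ) ∧ HasCompactSupport (dz ψ)) ∧
      (ContDiff ℝ ∞ (dzbar ψ) ∧ HasCompactSupport (dzbar ψ)) := by
    intro ψ h1 h2
    have h3 : ContDiff ℝ ∞ (fderiv ℝ ψ) := h1.fderiv_right (by norm_cast)
    have h4 : HasCompactSupport (fderiv ℝ ψ) := h2.fderiv ℝ
    refine ⟨⟨?_, ?_⟩, ?_, ?_⟩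
    · unfold dz; fun_prop
    · exact h4.comp_left (g := fun L : ℂ →L[ℝ] ℂ => (1 / 2) * (L 1 - Complex.I * L Complex.I))
        (by simp)
    · unfold dzbar; fun_prop
    · exact h4.comp_left (g := fun L : ℂ →L[ℝ] ℂ => (1 / 2) * (L 1 + Complex.I * L Complex.I))
        (by simp)
  have hb := (key φ hφ hc).2
  have hzb := (key _ hb.1 hb.2).1
  have hcont : Continuous fun z => landau φ z - n * φ z := by
    have := hφ.continuous
    have := hb.1.continuous
    have := hzb.1.continuous
    unfold landau
    fun_prop
  refine hcont.memLp_of_hasCompactSupport ?_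
  have a1 : HasCompactSupport fun z => -dz (dzbar φ) z := hzb.2.neg
  have a2 : HasCompactSupport fun z => conj z * dzbar φ z := hb.2.mul_left
  have a3 : HasCompactSupport fun z => (n : ℂ) * φ z := hc.mul_left
  exact (a1.add a2).sub a3

/-- The pairing `∫ f conj (Δφ - nφ) dμ` with a test function is an inner product. -/
theorem pairing_eq_inner (n : ℕ) (f : GaussL2) {φ : ℂ → ℂ} (hφ : ContDiff ℝ ∞ φ)
    (hc : HasCompactSupport φ) :
    ∫ z, f z * conj (landau φ z - n * φ z) ∂gaussMeasure =
      inner ℂ (landau_sub_memLp n hφ hc).toLp f := by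
  rw [L2.inner_def]
  refine integral_congr_ae ?_
  filter_upwards [(landau_sub_memLp n hφ hc).coeFn_toLp] with z hz
  rw [hz, RCLike.inner_apply]

/-- The true poly-Bargmann space `A²_n = ker (Δ - n)`: the `L²`-eigenspace of the Landau operator
for the eigenvalue `n`. The equation `Δ f = n f` is understood weakly, against smooth compactly
supported test functions; `Δ` is formally self-adjoint in `L²(μ)`. -/
def bargmann (n : ℕ) : Submodule ℂ GaussL2 where
  carrier := {f | ∀ φ : ℂ → ℂ, ContDiff ℝ ∞ φ → HasCompactSupport φ →
    ∫ z, f z * conj (landau φ z - n * φ z) ∂gaussMeasure = 0}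
  zero_mem' φ hφ hc := by rw [pairing_eq_inner n _ hφ hc, inner_zero_right]
  add_mem' {f g} hf hg φ hφ hc := by
    have h1 := hf φ hφ hc
    have h2 := hg φ hφ hc
    rw [pairing_eq_inner n _ hφ hc] at h1 h2 ⊢
    rw [inner_add_right, h1, h2, add_zero]
  smul_mem' c f hf φ hφ hc := by
    have h1 := hf φ hφ hc
    rw [pairing_eq_inner n _ hφ hc] at h1 ⊢
    rw [inner_smul_right, h1, mul_zero]

theorem bargmann_isClosed (n : ℕ) : IsClosed (bargmann n : Set GaussL2) := by
  have h : (bargmann n : Set GaussL2) = ⋂ (φ : ℂ → ℂ) (hφ : ContDiff ℝ ∞ φ)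
      (hc : HasCompactSupport φ),
      {f : GaussL2 | inner ℂ (landau_sub_memLp n hφ hc).toLp f = 0} := by
    ext f
    simp only [Set.mem_iInter, Set.mem_ofPred_eq]
    refine forall_congr' fun φ => forall_congr' fun hφ => forall_congr' fun hc => ?_
    rw [pairing_eq_inner n _ hφ hc]
  rw [h]
  refine isClosed_iInter fun φ => isClosed_iInter fun hφ => isClosed_iInter fun hc => ?_
  exact isClosed_eq (by fun_prop) continuous_const

instance (n : ℕ) : CompleteSpace (bargmann n) :=
  (bargmann_isClosed n).completeSpace_coe

/-- The orthogonal projection `P_n` of `L²(μ)` onto `A²_n`. -/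
def bargmannProj (n : ℕ) : GaussL2 →L[ℂ] GaussL2 := (bargmann n).starProjection

/-- The closed linear span of the `H_{ℓ,n}`, `n = 0, 1, 2, …`. -/
def bargmannTilde (l : ℕ) : Submodule ℂ GaussL2 :=
  (Submodule.span ℂ (Set.range fun n : ℕ => hermiteVec l n)).topologicalClosure

/-! ### The ranges -/

/-- The range `R^ℓ_n = P_n C (A²_ℓ)`. -/
def cauchyRange (l n : ℕ) : Submodule ℂ GaussL2 :=
  (bargmann l).map ((bargmannProj n).toLinearMap ∘ₗ cauchyTransform)

/-- The range `P_n C (Ã²_ℓ)`, where `Ã²_ℓ` is the closed span of the `H_{ℓ,n}`. -/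
def cauchyRangeTilde (l n : ℕ) : Submodule ℂ GaussL2 :=
  (bargmannTilde l).map ((bargmannProj n).toLinearMap ∘ₗ cauchyTransform)

end WeightedCauchy

end

open WeightedCauchy

/-!
The argument works in the orthogonal basis of Ito-Hermite polynomials `H_{m,n}`, where the operator
`P_n C` becomes a weighted shift with explicitly known weights.

*Action of `C`.* The Rodrigues formula says `H_{m+1,l} e^{-|z|²} = -∂_z̄ (H_{m,l} e^{-|z|²})`, so the
Cauchy-Pompeiu formula gives `C H_{m+1,l} = -H_{m,l} e^{-|z|²}`
(`cauchyIntegral_hermitePoly_succ`). The matrix coefficient `⟨C H_{m,l}, H_{k,n}⟩` is then a Gaussian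
integral of a product of two Hermite polynomials with weight `e^{-2|z|²}`; integration by parts
collapses it to a single Hermite polynomial, and it vanishes unless `m + n = l + k + 1`
(`integral_hermitePoly_mul_hermitePoly_gauss_sq`, `integral_hermitePoly_mul_gauss_sq`).
For `m = 0` no closed form of `C H_{0,l}` is needed: the kernel `1 / (z - ξ)` is antisymmetric, so the
derivatives can be taken from the other factor as soon as `n > 0`
(`integral_cauchyIntegral_mul`), while for `m = n = 0` the coefficient vanishes by rotation
invariance (`integral_cauchyIntegral_conj_pow`).

*Spectral decomposition.* The `H_{m,n}` are orthogonal, and they are complete because a function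
orthogonal to all polynomials has vanishing Fourier transform against the Gaussian measure
(`eq_zero_of_inner_hermiteVec_eq_zero`). Integration by parts shows that `H_{m,n}` is a weak
eigenfunction of the Landau operator for the eigenvalue `n`, and testing against cutoffs of the
`H_{m,k}` shows that a weak eigenfunction for `n` is orthogonal to `H_{m,k}` when `k ≠ n`. Hence `A²_n`
consists of the convergent series in the `H_{m,n}`, `m = 0, 1, …` (`mem_bargmann_iff`).

*Conclusion.* `P_n C H_{j,l}` is zero for `n + j < l + 1` and otherwise a nonzero multiple of
`H_{n+j-l-1,n}` (`projCauchy_hermiteVec`), with the coefficient `(n+j-1)! / (2^j (n+j-l-1)!)` up to a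
factor independent of `j`. Applying the bounded operator `P_n C` to the expansions of the elements of
`A²_l` describes the first range. In the second range `j = l` is fixed and the second index of
`H_{l,b}` varies, so that only `b < n + l` contribute, and the range is finite-dimensional.
-/

namespace WeightedCauchy

/-! ### Wirtinger calculus -/

/-- `f` is real differentiable at `z` with Wirtinger derivatives `∂f/∂z = a` and `∂f/∂z̄ = b`,
that is, its differential is `v ↦ a v + b v̄`. -/
def HasWirtingerAt (f : ℂ → ℂ) (a b z : ℂ) : Prop :=
  HasFDerivAt f (a • (ContinuousLinearMap.id ℝ ℂ) + b • (Complex.conjCLE : ℂ →L[ℝ] ℂ)) z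

namespace HasWirtingerAt

variable {f g : ℂ → ℂ} {a b c d z : ℂ}

theorem fderiv_apply (h : HasWirtingerAt f a b z) (v : ℂ) :
    fderiv ℝ f z v = a * v + b * conj v := by
  rw [HasFDerivAt.fderiv h]
  simp

theorem dz_eq (h : HasWirtingerAt f a b z) : dz f z = a := by
  simp only [dz, h.fderiv_apply, map_one, Complex.conj_I]
  linear_combination (-(1 / 2) * a + 1 / 2 * b) * Complex.I_sq

theorem dzbar_eq (h : HasWirtingerAt f a b z) : dzbar f z = b := by
  simp only [dzbar, h.fderiv_apply, map_one, Complex.conj_I]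
  linear_combination ((1 / 2) * a - 1 / 2 * b) * Complex.I_sq

theorem congr (h : HasWirtingerAt f a b z) (ha : a = c) (hb : b = d) :
    HasWirtingerAt f c d z := ha ▸ hb ▸ h

theorem const (k : ℂ) : HasWirtingerAt (fun _ => k) 0 0 z := by
  refine HasFDerivAt.congr_fderiv (hasFDerivAt_const (𝕜 := ℝ) k z) ?_
  ext v; simp

theorem id : HasWirtingerAt (fun z => z) 1 0 z := by
  refine HasFDerivAt.congr_fderiv (hasFDerivAt_id (𝕜 := ℝ) z) ?_
  ext v; simp

theorem add (hf : HasWirtingerAt f a b z) (hg : HasWirtingerAt g c d z) :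
    HasWirtingerAt (fun z => f z + g z) (a + c) (b + d) z := by
  refine HasFDerivAt.congr_fderiv (HasFDerivAt.add hf hg) ?_
  ext v; simp; ring

theorem neg (hf : HasWirtingerAt f a b z) :
    HasWirtingerAt (fun z => -f z) (-a) (-b) z := by
  refine HasFDerivAt.congr_fderiv (HasFDerivAt.neg hf) ?_
  ext v; simp; ring

theorem sub (hf : HasWirtingerAt f a b z) (hg : HasWirtingerAt g c d z) :
    HasWirtingerAt (fun z => f z - g z) (a - c) (b - d) z := by
  refine HasFDerivAt.congr_fderiv (HasFDerivAt.sub hf hg) ?_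
  ext v; simp; ring

theorem mul (hf : HasWirtingerAt f a b z) (hg : HasWirtingerAt g c d z) :
    HasWirtingerAt (fun z => f z * g z) (a * g z + f z * c) (b * g z + f z * d) z := by
  refine HasFDerivAt.congr_fderiv (HasFDerivAt.mul hf hg) ?_
  ext v; simp; ring

theorem const_mul (k : ℂ) (hf : HasWirtingerAt f a b z) :
    HasWirtingerAt (fun z => k * f z) (k * a) (k * b) z :=
  ((const k).mul hf).congr (by ring) (by ring)

theorem conjugate (hf : HasWirtingerAt f a b z) :
    HasWirtingerAt (fun z => conj (f z)) (conj b) (conj a) z := by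
  refine HasFDerivAt.congr_fderiv
    ((Complex.conjCLE : ℂ →L[ℝ] ℂ).hasFDerivAt.comp z hf) ?_
  ext v; simp; ring

theorem comp_hasDerivAt {γ : ℝ → ℂ} {γ' : ℂ} {t : ℝ} (h : HasWirtingerAt f a b (γ t))
    (hγ : HasDerivAt γ γ' t) :
    HasDerivAt (fun t => f (γ t)) (a * γ' + b * starRingEnd ℂ γ') t := by
  refine HasDerivAt.congr_deriv (HasFDerivAt.comp_hasDerivAt t (f := γ) (l := f)
    (show HasFDerivAt f _ (γ t) from h) hγ) ?_
  simp

theorem comp_const_add (w : ℂ) (h : HasWirtingerAt f a b (w + z)) :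
    HasWirtingerAt (fun z => f (w + z)) a b z := by
  refine HasFDerivAt.congr_fderiv (HasFDerivAt.comp z (f := fun z => w + z) (g := f)
    (show HasFDerivAt f _ (w + z) from h) ((hasFDerivAt_id z).const_add w)) ?_
  ext v; simp

/-- Every real differentiable function has its Wirtinger derivatives as the coefficients of its
differential. -/
theorem of_differentiableAt (h : DifferentiableAt ℝ f z) :
    HasWirtingerAt f (dz f z) (dzbar f z) z := by
  refine HasFDerivAt.congr_fderiv h.hasFDerivAt ?_
  refine ContinuousLinearMap.ext fun v => ?_
  have h1 : v = v.re • (1 : ℂ) + v.im • Complex.I := by simp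
  have h2 : fderiv ℝ f z v = v.re * fderiv ℝ f z 1 + v.im * fderiv ℝ f z Complex.I := by
    conv_lhs => rw [h1, map_add, map_smul, map_smul]
    simp
  have h3 : (starRingEnd ℂ) v = v.re - v.im * Complex.I := by
    apply Complex.ext <;> simp
  rw [h2]
  simp only [dz, dzbar, _root_.add_apply, _root_.smul_apply, ContinuousLinearMap.id_apply,
    ContinuousLinearEquiv.coe_coe, Complex.conjCLE_apply, smul_eq_mul, h3]
  conv_rhs => rw [← Complex.re_add_im v]
  simp only [Complex.add_re, Complex.ofReal_re, Complex.mul_re, Complex.I_re, mul_zero,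
    Complex.ofReal_im, Complex.I_im, mul_one, sub_self, add_zero, Complex.add_im, Complex.mul_im,
    zero_add]
  linear_combination (v.im * fderiv ℝ f z Complex.I) * Complex.I_sq

theorem gauss : HasWirtingerAt gauss (-(starRingEnd ℂ z) * gauss z) (-z * gauss z) z := by
  have h := of_differentiableAt (gauss_differentiable z)
  refine h.congr ?_ ?_
  · simp only [dz, fderiv_gauss, map_one, Complex.conj_I]
    linear_combination (1 / 2 * starRingEnd ℂ z - 1 / 2 * z) * WeightedCauchy.gauss z * Complex.I_sq
  · simp only [dzbar, fderiv_gauss, map_one, Complex.conj_I]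
    linear_combination
      (-1 / 2 * starRingEnd ℂ z + 1 / 2 * z) * WeightedCauchy.gauss z * Complex.I_sq

end HasWirtingerAt

/-! ### The Ito-Hermite polynomials -/

/-- The Ito-Hermite polynomials, by the recursion `H_{m+1,n} = z H_{m,n} - n H_{m,n-1}` from
`H_{0,n} = z̄^n`. For `n = 0` the truncated index `n - 1` is harmless, as its coefficient is `0`. -/
def hermitePoly : ℕ → ℕ → ℂ → ℂ
  | 0, n => fun z => conj z ^ n
  | m + 1, n => fun z => z * hermitePoly m n z - n * hermitePoly m (n - 1) z

theorem hermitePoly_zero_left (n : ℕ) (z : ℂ) : hermitePoly 0 n z = conj z ^ n := rfl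

theorem hermitePoly_succ_left (m n : ℕ) (z : ℂ) :
    hermitePoly (m + 1) n z = z * hermitePoly m n z - n * hermitePoly m (n - 1) z := rfl

theorem hermitePoly_succ_right (m n : ℕ) (z : ℂ) :
    hermitePoly m (n + 1) z = conj z * hermitePoly m n z - m * hermitePoly (m - 1) n z := by
  induction m generalizing n with
  | zero => simp [hermitePoly_zero_left, pow_succ, mul_comm]
  | succ m ih =>
    simp only [hermitePoly_succ_left, Nat.add_sub_cancel]
    rw [ih n]
    rcases m with _ | m
    · rcases n with _ | n
      · simp [hermitePoly_zero_left]; ring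
      · simp [hermitePoly_zero_left]; ring
    · rcases n with _ | n
      · have h := hermitePoly_succ_left m 0 z
        simp only [Nat.add_sub_cancel, Nat.zero_sub] at h ⊢
        push_cast at h ⊢
        linear_combination (m + 1 : ℂ) * h
      · have h := hermitePoly_succ_left m (n + 1) z
        have h2 := ih n
        simp only [Nat.add_sub_cancel] at h h2 ⊢
        push_cast at h h2 ⊢
        linear_combination (m + 1 : ℂ) * h - (n + 1 : ℂ) * h2

theorem conj_hermitePoly (m n : ℕ) (z : ℂ) : conj (hermitePoly m n z) = hermitePoly n m z := by
  induction m generalizing n with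
  | zero =>
    have h : ∀ n, hermitePoly n 0 z = z ^ n := by
      intro n
      induction n with
      | zero => simp [hermitePoly_zero_left]
      | succ n ih => rw [hermitePoly_succ_left, ih]; simp [pow_succ, mul_comm]
    simp [hermitePoly_zero_left, h]
  | succ m ih =>
    rw [hermitePoly_succ_left, hermitePoly_succ_right, map_sub, map_mul, map_mul, ih, ih]
    simp

theorem hasWirtingerAt_conj_pow (n : ℕ) (z : ℂ) :
    HasWirtingerAt (fun z => conj z ^ n) 0 (n * conj z ^ (n - 1)) z := by
  induction n with
  | zero => simpa using HasWirtingerAt.const 1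
  | succ n ih =>
    have h := ih.mul (HasWirtingerAt.id (z := z)).conjugate
    simp only [← pow_succ] at h
    refine h.congr (by simp) ?_
    rcases n with _ | n
    · simp
    · simp only [map_one, Nat.add_sub_cancel]; push_cast; ring

theorem hasWirtingerAt_hermitePoly (m n : ℕ) (z : ℂ) :
    HasWirtingerAt (hermitePoly m n) (m * hermitePoly (m - 1) n z)
      (n * hermitePoly m (n - 1) z) z := by
  induction m generalizing n with
  | zero => exact (hasWirtingerAt_conj_pow n z).congr (by simp) (by simp [hermitePoly])
  | succ m ih =>
    have h := (HasWirtingerAt.id.mul (ih n)).sub ((ih (n - 1)).const_mul n)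
    refine h.congr ?_ ?_
    · rcases m with _ | m
      · simp
      · have h := hermitePoly_succ_left m n z
        simp only [Nat.add_sub_cancel]
        push_cast
        linear_combination -(m + 1 : ℂ) * h
    · rw [hermitePoly_succ_left]
      rcases n with _ | n
      · simp
      · simp only [Nat.add_sub_cancel]
        push_cast
        ring

/-- Differentiating `H_{m,n} e^{-|z|²}` raises an index of the Hermite polynomial and changes the
sign; this is the inductive step of the Rodrigues formula. -/
theorem hasWirtingerAt_hermitePoly_mul_gauss (m n : ℕ) (z : ℂ) :
    HasWirtingerAt (fun z => hermitePoly m n z * gauss z) (-hermitePoly m (n + 1) z * gauss z)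
      (-hermitePoly (m + 1) n z * gauss z) z := by
  refine ((hasWirtingerAt_hermitePoly m n z).mul HasWirtingerAt.gauss).congr ?_ ?_
  · rw [hermitePoly_succ_right]; ring
  · rw [hermitePoly_succ_left]; ring

theorem iterate_dzbar_dz_gauss (m n : ℕ) :
    dzbar^[m] (dz^[n] gauss) = fun z => (-1) ^ (m + n) * (hermitePoly m n z * gauss z) := by
  induction m with
  | zero =>
    induction n with
    | zero => funext z; simp [hermitePoly_zero_left]
    | succ n ih =>
      simp only [Function.iterate_zero, id_eq] at ih ⊢
      rw [Function.iterate_succ_apply', ih]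
      funext z
      rw [((hasWirtingerAt_hermitePoly_mul_gauss 0 n z).const_mul _).dz_eq]
      ring
  | succ m ih =>
    rw [Function.iterate_succ_apply', ih]
    funext z
    rw [((hasWirtingerAt_hermitePoly_mul_gauss m n z).const_mul _).dzbar_eq]
    ring

theorem itoHermite_eq_hermitePoly (m n : ℕ) : itoHermite m n = hermitePoly m n := by
  funext z
  have h1 : (Real.exp (‖z‖ ^ 2) : ℂ) * gauss z = 1 := by
    rw [gauss, ← Complex.ofReal_mul, ← Real.exp_add]
    simp
  have h2 : ((-1 : ℂ) ^ (m + n)) * (-1) ^ (m + n) = 1 := by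
    rw [← mul_pow]; simp
  rw [itoHermite, iterate_dzbar_dz_gauss]
  linear_combination hermitePoly m n z * (((-1 : ℂ) ^ (m + n)) * (-1) ^ (m + n)) * h1 +
    hermitePoly m n z * h2

/-! ### Polynomial growth -/

/-- Continuous functions on the plane of at most polynomial growth. The powers of `1 + |z|²` serve as
comparison functions. -/
def PolyGrowth (p : ℂ → ℂ) : Prop :=
  Continuous p ∧ ∃ (C : ℝ) (N : ℕ), 0 ≤ C ∧ ∀ z, ‖p z‖ ≤ C * (1 + ‖z‖ ^ 2) ^ N

namespace PolyGrowth

variable {p q : ℂ → ℂ}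

theorem const (c : ℂ) : PolyGrowth fun _ => c :=
  ⟨continuous_const, ‖c‖, 0, norm_nonneg c, fun z => by simp⟩

theorem id : PolyGrowth fun z => z := by
  refine ⟨continuous_id, 1, 1, zero_le_one, fun z => ?_⟩
  nlinarith [sq_nonneg (‖z‖ - 1)]

theorem conjugate (hp : PolyGrowth p) : PolyGrowth fun z => conj (p z) := by
  obtain ⟨h, C, N, hC, hN⟩ := hp
  exact ⟨Complex.continuous_conj.comp h, C, N, hC, fun z => by simpa using hN z⟩

theorem add (hp : PolyGrowth p) (hq : PolyGrowth q) : PolyGrowth fun z => p z + q z := by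
  obtain ⟨h, C, N, hC, hN⟩ := hp
  obtain ⟨h', C', N', hC', hN'⟩ := hq
  refine ⟨h.add h', C + C', max N N', by positivity, fun z => ?_⟩
  have h1 : (1 : ℝ) ≤ 1 + ‖z‖ ^ 2 := by nlinarith [sq_nonneg ‖z‖]
  calc ‖p z + q z‖ ≤ C * (1 + ‖z‖ ^ 2) ^ N + C' * (1 + ‖z‖ ^ 2) ^ N' :=
        (norm_add_le _ _).trans (add_le_add (hN z) (hN' z))
    _ ≤ C * (1 + ‖z‖ ^ 2) ^ max N N' + C' * (1 + ‖z‖ ^ 2) ^ max N N' := by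
        gcongr <;> first | exact h1 | simp
    _ = _ := by ring

theorem mul (hp : PolyGrowth p) (hq : PolyGrowth q) : PolyGrowth fun z => p z * q z := by
  obtain ⟨h, C, N, hC, hN⟩ := hp
  obtain ⟨h', C', N', hC', hN'⟩ := hq
  refine ⟨h.mul h', C * C', N + N', by positivity, fun z => ?_⟩
  rw [norm_mul]
  calc ‖p z‖ * ‖q z‖ ≤ (C * (1 + ‖z‖ ^ 2) ^ N) * (C' * (1 + ‖z‖ ^ 2) ^ N') :=
        mul_le_mul (hN z) (hN' z) (norm_nonneg _) (by positivity)
    _ = _ := by ring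

theorem neg (hp : PolyGrowth p) : PolyGrowth fun z => -p z := by
  simpa using (const (-1)).mul hp

theorem sub (hp : PolyGrowth p) (hq : PolyGrowth q) : PolyGrowth fun z => p z - q z := by
  simpa only [sub_eq_add_neg] using hp.add hq.neg

theorem gauss : PolyGrowth gauss := by
  refine ⟨gauss_differentiable.continuous, 1, 0, zero_le_one, fun z => ?_⟩
  simp only [WeightedCauchy.gauss, Complex.norm_real, Real.norm_eq_abs, Real.abs_exp, pow_zero,
    mul_one, Real.exp_le_one_iff]
  nlinarith [sq_nonneg ‖z‖]

/-- A function of polynomial growth times the Gaussian decays faster than every power. -/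
theorem norm_mul_gauss_le (hp : PolyGrowth p) (k : ℕ) :
    ∃ K, 0 ≤ K ∧ ∀ z, ‖p z * WeightedCauchy.gauss z‖ ≤ K * ((1 + ‖z‖ ^ 2) ^ k)⁻¹ := by
  obtain ⟨h, C, N, hC, hN⟩ := hp
  refine ⟨C * ((N + k).factorial * Real.exp 1), by positivity, fun z => ?_⟩
  have h1 : (0 : ℝ) < 1 + ‖z‖ ^ 2 := by positivity
  have h2 := Real.pow_div_factorial_le_exp (1 + ‖z‖ ^ 2) h1.le (N + k)
  rw [div_le_iff₀ (by positivity), Real.exp_add] at h2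
  have h3 : Real.exp (‖z‖ ^ 2) * Real.exp (-‖z‖ ^ 2) = 1 := by
    rw [← Real.exp_add]; simp
  have h4 : (1 + ‖z‖ ^ 2) ^ (N + k) * Real.exp (-‖z‖ ^ 2) ≤ (N + k).factorial * Real.exp 1 := by
    calc _ ≤ (Real.exp 1 * Real.exp (‖z‖ ^ 2) * (N + k).factorial) * Real.exp (-‖z‖ ^ 2) := by
          gcongr
      _ = (N + k).factorial * Real.exp 1 * (Real.exp (‖z‖ ^ 2) * Real.exp (-‖z‖ ^ 2)) := by ring
      _ = _ := by rw [h3, mul_one]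
  rw [← div_eq_mul_inv, le_div_iff₀ (by positivity), norm_mul]
  have h5 : ‖WeightedCauchy.gauss z‖ = Real.exp (-‖z‖ ^ 2) := by
    simp only [WeightedCauchy.gauss, Complex.norm_real, Real.norm_eq_abs, Real.abs_exp]
  rw [h5]
  calc _ ≤ (C * (1 + ‖z‖ ^ 2) ^ N) * Real.exp (-‖z‖ ^ 2) * (1 + ‖z‖ ^ 2) ^ k := by
        gcongr; exact hN z
    _ = C * ((1 + ‖z‖ ^ 2) ^ (N + k) * Real.exp (-‖z‖ ^ 2)) := by ring
    _ ≤ _ := by gcongr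

theorem hermitePoly (m n : ℕ) : PolyGrowth (hermitePoly m n) := by
  induction m generalizing n with
  | zero =>
    induction n with
    | zero => simpa [WeightedCauchy.hermitePoly] using const 1
    | succ n ih =>
      simp only [WeightedCauchy.hermitePoly, pow_succ] at ih ⊢
      exact ih.mul id.conjugate
  | succ m ih => exact (id.mul (ih n)).sub ((const n).mul (ih (n - 1)))

theorem memLp_two (hp : PolyGrowth p) : MemLp p 2 gaussMeasure := by
  obtain ⟨h, C, N, hC, hN⟩ := hp
  have h1 : MemLp (fun z : ℂ => (C : ℂ) * (1 + z ^ 1 * starRingEnd ℂ z ^ 1) ^ N) 2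
      gaussMeasure := by
    simp only [add_comm (1 : ℂ), add_pow, one_pow, mul_one, Finset.mul_sum, mul_pow, ← pow_mul]
    refine memLp_finsetSum _ fun i _ => ?_
    refine ((memLp_monomial (1 * i) (1 * i)).const_mul ((C : ℂ) * (N.choose i))).ae_eq
      (Filter.Eventually.of_forall fun z => ?_)
    simp only
    ring
  refine h1.mono h.aestronglyMeasurable (Filter.Eventually.of_forall fun z => (hN z).trans ?_)
  have h2 : (1 + z ^ 1 * starRingEnd ℂ z ^ 1 : ℂ) = ((1 + ‖z‖ ^ 2 : ℝ) : ℂ) := by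
    simp [Complex.mul_conj, Complex.normSq_eq_norm_sq]
  rw [h2, norm_mul, norm_pow, Complex.norm_real, Complex.norm_real, Real.norm_of_nonneg hC,
    Real.norm_of_nonneg (by positivity)]

end PolyGrowth

/-- Integrals against the Gaussian measure as integrals over the plane. -/
theorem integral_gaussMeasure (f : ℂ → ℂ) :
    ∫ z, f z ∂gaussMeasure = ∫ z, f z * gauss z := by
  rw [gaussMeasure, integral_withDensity_eq_integral_toReal_smul measurable_density
    (Filter.Eventually.of_forall fun _ => ENNReal.ofReal_lt_top)]
  refine integral_congr_ae (Filter.Eventually.of_forall fun z => ?_)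
  simp only [ENNReal.toReal_ofReal (Real.exp_pos _).le, gauss, Complex.real_smul]
  ring

theorem integrable_gaussMeasure_iff {f : ℂ → ℂ} :
    Integrable f gaussMeasure ↔ Integrable fun z => f z * gauss z := by
  rw [gaussMeasure, integrable_withDensity_iff_integrable_smul' measurable_density
    (Filter.Eventually.of_forall fun _ => ENNReal.ofReal_lt_top)]
  simp only [ENNReal.toReal_ofReal (Real.exp_pos _).le, gauss, Complex.real_smul, mul_comm]

theorem PolyGrowth.integrable {p : ℂ → ℂ} (hp : PolyGrowth p) : Integrable p gaussMeasure :=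
  hp.memLp_two.integrable one_le_two

theorem PolyGrowth.integrable_mul_gauss {p : ℂ → ℂ} (hp : PolyGrowth p) :
    Integrable fun z => p z * WeightedCauchy.gauss z :=
  integrable_gaussMeasure_iff.1 hp.integrable

/-- The integral over the plane of a Wirtinger derivative of an integrable function vanishes. All
integrations by parts are instances of this. -/
theorem integral_wirtinger_eq_zero {f a b : ℂ → ℂ} (h : ∀ z, HasWirtingerAt f (a z) (b z) z)
    (hf : Integrable f) (ha : Integrable a) (hb : Integrable b) :
    ∫ z, a z = 0 ∧ ∫ z, b z = 0 := by
  have key : ∀ v : ℂ, ∫ z, (a z * v + b z * conj v) = 0 := by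
    intro v
    have hi : Integrable fun z => a z * v + b z * conj v :=
      (ha.mul_const v).add (hb.mul_const _)
    have h1 := integral_mul_fderiv_eq_neg_fderiv_mul_of_integrable (μ := (volume : Measure ℂ))
      (f := f) (g := fun _ => (1 : ℂ)) (v := v)
      (by simpa only [(h _).fderiv_apply, mul_one] using hi) (by simp) (by simpa using hf)
      (fun x _ => (h x).differentiableAt) (fun x _ => differentiableAt_const _)
    simpa [(h _).fderiv_apply] using h1.symm
  have h1 := key 1
  have h2 := key Complex.I
  rw [integral_add (ha.mul_const _) (hb.mul_const _), integral_mul_const,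
    integral_mul_const] at h1 h2
  simp only [map_one, Complex.conj_I] at h1 h2
  constructor
  · linear_combination (1 / 2) * h1 - Complex.I / 2 * h2 +
      (1 / 2 * (∫ z, a z) - 1 / 2 * ∫ z, b z) * Complex.I_sq
  · linear_combination (1 / 2) * h1 + Complex.I / 2 * h2 -
      (1 / 2 * (∫ z, a z) - 1 / 2 * ∫ z, b z) * Complex.I_sq

/-! ### Gaussian integrals of Ito-Hermite polynomials -/

/-- In `L²(μ)`, raising the first index is adjoint to `∂_z̄` (in bilinear form). -/
theorem integral_hermitePoly_mul_gauss_mul_left {p a b : ℂ → ℂ} (hp : PolyGrowth p)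
    (ha : PolyGrowth a) (hb : PolyGrowth b) (h : ∀ z, HasWirtingerAt p (a z) (b z) z) (m n : ℕ) :
    ∫ z, hermitePoly (m + 1) n z * p z * gauss z = ∫ z, hermitePoly m n z * b z * gauss z := by
  have hH := PolyGrowth.hermitePoly
  have h1 := (integral_wirtinger_eq_zero
    (a := fun z => (-hermitePoly m (n + 1) z * p z + hermitePoly m n z * a z) * gauss z)
    (b := fun z => (hermitePoly m n z * b z * gauss z - hermitePoly (m + 1) n z * p z * gauss z))
    (fun z => ((hasWirtingerAt_hermitePoly_mul_gauss m n z).mul (h z)).congr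
      (by ring) (by ring))
    ?_ ?_ ?_).2
  · rw [integral_sub ((hH _ _).mul hb).integrable_mul_gauss
      ((hH _ _).mul hp).integrable_mul_gauss] at h1
    exact (sub_eq_zero.1 h1).symm
  · refine ((hH m n).mul hp).integrable_mul_gauss.congr (Filter.Eventually.of_forall fun z => ?_)
    simp only; ring
  · exact (((hH _ _).neg.mul hp).add ((hH _ _).mul ha)).integrable_mul_gauss
  · exact ((hH _ _).mul hb).integrable_mul_gauss.sub ((hH _ _).mul hp).integrable_mul_gauss

/-- In `L²(μ)`, raising the second index is adjoint to `∂_z` (in bilinear form). -/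
theorem integral_hermitePoly_mul_gauss_mul_right {p a b : ℂ → ℂ} (hp : PolyGrowth p)
    (ha : PolyGrowth a) (hb : PolyGrowth b) (h : ∀ z, HasWirtingerAt p (a z) (b z) z) (m n : ℕ) :
    ∫ z, hermitePoly m (n + 1) z * p z * gauss z = ∫ z, hermitePoly m n z * a z * gauss z := by
  have hH := PolyGrowth.hermitePoly
  have h1 := (integral_wirtinger_eq_zero
    (a := fun z => (hermitePoly m n z * a z * gauss z - hermitePoly m (n + 1) z * p z * gauss z))
    (b := fun z => (-hermitePoly (m + 1) n z * p z + hermitePoly m n z * b z) * gauss z)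
    (fun z => ((hasWirtingerAt_hermitePoly_mul_gauss m n z).mul (h z)).congr
      (by ring) (by ring))
    ?_ ?_ ?_).1
  · rw [integral_sub ((hH _ _).mul ha).integrable_mul_gauss
      ((hH _ _).mul hp).integrable_mul_gauss] at h1
    exact (sub_eq_zero.1 h1).symm
  · refine ((hH m n).mul hp).integrable_mul_gauss.congr (Filter.Eventually.of_forall fun z => ?_)
    simp only; ring
  · exact ((hH _ _).mul ha).integrable_mul_gauss.sub ((hH _ _).mul hp).integrable_mul_gauss
  · exact (((hH _ _).neg.mul hp).add ((hH _ _).mul hb)).integrable_mul_gauss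

theorem integral_gauss : ∫ z, gauss z = Real.pi := by
  have h := Complex.integral_exp_neg_rpow (p := 2) (by norm_num)
  have h1 : ∫ z, gauss z = ((∫ z : ℂ, Real.exp (-‖z‖ ^ (2 : ℝ)) : ℝ) : ℂ) := by
    rw [← integral_complex_ofReal]
    simp [gauss]
  rw [h1, h]
  norm_num

theorem integral_gauss_mul_gauss : ∫ z, gauss z * gauss z = Real.pi / 2 := by
  have h := Complex.integral_exp_neg_mul_rpow (p := 2) (b := 2) (by norm_num) (by norm_num)
  have h1 : ∫ z, gauss z * gauss z = ((∫ z : ℂ, Real.exp (-2 * ‖z‖ ^ (2 : ℝ)) : ℝ) : ℂ) := by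
    rw [← integral_complex_ofReal]
    congr 1
    funext z
    rw [gauss, ← Complex.ofReal_mul, ← Real.exp_add]
    congr 2
    simp
    ring
  rw [h1, h]
  norm_num [Real.rpow_neg_one]
  ring

/-- The bilinear orthogonality relations of the Ito-Hermite polynomials. -/
theorem integral_hermitePoly_mul_hermitePoly (a b c d : ℕ) :
    ∫ z, hermitePoly a b z * hermitePoly c d z * gauss z =
      if a = d ∧ b = c then (Real.pi : ℂ) * a.factorial * b.factorial else 0 := by
  have hH := PolyGrowth.hermitePoly
  have hl : ∀ a b c d : ℕ, ∫ z, hermitePoly (a + 1) b z * hermitePoly c d z * gauss z =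
      d * ∫ z, hermitePoly a b z * hermitePoly c (d - 1) z * gauss z := by
    intro a b c d
    rw [integral_hermitePoly_mul_gauss_mul_left (hH c d)
      ((PolyGrowth.const _).mul (hH _ _)) ((PolyGrowth.const _).mul (hH _ _))
      (hasWirtingerAt_hermitePoly c d), ← integral_const_mul]
    congr 1; funext z; ring
  have hr : ∀ a b c d : ℕ, ∫ z, hermitePoly a (b + 1) z * hermitePoly c d z * gauss z =
      c * ∫ z, hermitePoly a b z * hermitePoly (c - 1) d z * gauss z := by
    intro a b c d
    rw [integral_hermitePoly_mul_gauss_mul_right (hH c d)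
      ((PolyGrowth.const _).mul (hH _ _)) ((PolyGrowth.const _).mul (hH _ _))
      (hasWirtingerAt_hermitePoly c d), ← integral_const_mul]
    congr 1; funext z; ring
  have h0 : ∀ c d : ℕ, ∫ z, hermitePoly 0 0 z * hermitePoly c d z * gauss z =
      if 0 = d ∧ 0 = c then (Real.pi : ℂ) else 0 := by
    intro c d
    have hs : ∀ z, hermitePoly 0 0 z * hermitePoly c d z * gauss z =
        hermitePoly c d z * hermitePoly 0 0 z * gauss z := fun z => by ring
    simp only [hs]
    rcases c with _ | c
    · rcases d with _ | d
      · simp [hermitePoly_zero_left, integral_gauss]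
      · rw [hr]; simp
    · rw [hl]; simp
  induction a generalizing d with
  | zero =>
    induction b generalizing c with
    | zero => simpa using h0 c d
    | succ b ih =>
      rw [hr, ih]
      rcases c with _ | c
      · simp
      · simp only [Nat.add_sub_cancel, Nat.add_right_cancel_iff, Nat.factorial_succ]
        split_ifs with h
        · rw [h.2]; push_cast; ring
        · simp
  | succ a ih =>
    rw [hl, ih]
    rcases d with _ | d
    · simp
    · simp only [Nat.add_sub_cancel, Nat.add_right_cancel_iff, Nat.factorial_succ]
      split_ifs with h
      · rw [h.1]; push_cast; ring
      · simp

/-- With the square of the Gaussian as weight, integration by parts moves all the derivatives in the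
Rodrigues formula of one factor onto the other one, which becomes `H_{a+c,b+d}`. -/
theorem integral_hermitePoly_mul_hermitePoly_gauss_sq (a b c d : ℕ) :
    ∫ z, hermitePoly a b z * hermitePoly c d z * gauss z * gauss z =
      (-1) ^ (a + b) * ∫ z, hermitePoly (a + c) (b + d) z * gauss z * gauss z := by
  have hH := PolyGrowth.hermitePoly
  have hG := PolyGrowth.gauss
  have hl : ∀ a b c d : ℕ,
      ∫ z, hermitePoly (a + 1) b z * hermitePoly c d z * gauss z * gauss z =
      - ∫ z, hermitePoly a b z * hermitePoly (c + 1) d z * gauss z * gauss z := by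
    intro a b c d
    have h := integral_hermitePoly_mul_gauss_mul_left ((hH c d).mul hG)
      ((hH _ _).neg.mul hG) ((hH _ _).neg.mul hG)
      (hasWirtingerAt_hermitePoly_mul_gauss c d) a b
    simp only [← mul_assoc] at h
    rw [h, ← integral_neg]
    congr 1; funext z; ring
  have hr : ∀ a b c d : ℕ,
      ∫ z, hermitePoly a (b + 1) z * hermitePoly c d z * gauss z * gauss z =
      - ∫ z, hermitePoly a b z * hermitePoly c (d + 1) z * gauss z * gauss z := by
    intro a b c d
    have h := integral_hermitePoly_mul_gauss_mul_right ((hH c d).mul hG)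
      ((hH _ _).neg.mul hG) ((hH _ _).neg.mul hG)
      (hasWirtingerAt_hermitePoly_mul_gauss c d) a b
    simp only [← mul_assoc] at h
    rw [h, ← integral_neg]
    congr 1; funext z; ring
  induction a generalizing c with
  | zero =>
    induction b generalizing d with
    | zero => simp [hermitePoly_zero_left 0]
    | succ b ih =>
      rw [hr, ih, show b + (d + 1) = b + 1 + d by ring]
      ring
  | succ a ih =>
    rw [hl, ih, show a + (c + 1) = a + 1 + c by ring]
    ring

/-- The index pair decreases by `(1, 1)` at the cost of the factor `-m / 2`, until an index is `0`. -/
theorem integral_hermitePoly_mul_gauss_sq (m n : ℕ) :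
    ∫ z, hermitePoly m n z * gauss z * gauss z =
      if m = n then (-1 / 2) ^ m * m.factorial * (Real.pi / 2 : ℂ) else 0 := by
  have hH := PolyGrowth.hermitePoly
  have hG := PolyGrowth.gauss
  have hgrow : ∀ m n, Integrable fun z => hermitePoly m n z * gauss z * gauss z := fun m n =>
    ((hH m n).mul hG).integrable_mul_gauss
  have hr : ∀ m n : ℕ, ∫ z, hermitePoly m (n + 1) z * gauss z * gauss z =
      - m / 2 * ∫ z, hermitePoly (m - 1) n z * gauss z * gauss z := by
    intro m n
    have h := integral_hermitePoly_mul_gauss_mul_right hG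
      (PolyGrowth.id.conjugate.neg.mul hG) (PolyGrowth.id.neg.mul hG)
      (fun z => HasWirtingerAt.gauss) m n
    have e : ∀ z, hermitePoly m n z * (-(starRingEnd ℂ) z * gauss z) * gauss z =
        -(hermitePoly m (n + 1) z * gauss z * gauss z) -
          m * (hermitePoly (m - 1) n z * gauss z * gauss z) := by
      intro z
      rw [hermitePoly_succ_right]; ring
    simp only [e] at h
    rw [integral_sub (hgrow m (n + 1)).fun_neg ((hgrow _ _).const_mul _), integral_neg,
      integral_const_mul] at h
    linear_combination (1 / 2) * h
  have hl : ∀ m : ℕ, ∫ z, hermitePoly (m + 1) 0 z * gauss z * gauss z = 0 := by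
    intro m
    have h := integral_hermitePoly_mul_gauss_mul_left hG
      (PolyGrowth.id.conjugate.neg.mul hG) (PolyGrowth.id.neg.mul hG)
      (fun z => HasWirtingerAt.gauss) m 0
    have e : ∀ z, hermitePoly m 0 z * (-z * gauss z) * gauss z =
        -(hermitePoly (m + 1) 0 z * gauss z * gauss z) := by
      intro z
      rw [hermitePoly_succ_left]; push_cast; ring
    simp only [e] at h
    rw [integral_neg] at h
    linear_combination (1 / 2) * h
  induction n generalizing m with
  | zero =>
    rcases m with _ | m
    · simpa [hermitePoly_zero_left] using integral_gauss_mul_gauss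
    · rw [hl]; simp
  | succ n ih =>
    rw [hr, ih]
    rcases m with _ | m
    · simp
    · simp only [Nat.add_sub_cancel, Nat.add_right_cancel_iff, Nat.factorial_succ]
      split_ifs with h
      · push_cast; ring
      · simp

/-! ### The Cauchy-Pompeiu formula -/

theorem integrable_polar_of_norm_le {u : ℝ × ℝ → ℂ} (hu : Continuous u) {K : ℝ}
    (hK : ∀ p, ‖u p‖ ≤ K * (1 + p.1 ^ 2)⁻¹) :
    Integrable u (((volume : Measure ℝ).restrict (Set.Ioi 0)).prod
      ((volume : Measure ℝ).restrict (Set.Ioo (-Real.pi) Real.pi))) := by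
  have h1 : Integrable (fun r : ℝ => K * (1 + r ^ 2)⁻¹)
      ((volume : Measure ℝ).restrict (Set.Ioi 0)) :=
    (integrable_inv_one_add_sq.const_mul K).restrict
  refine (h1.comp_fst _).mono' hu.aestronglyMeasurable (Filter.Eventually.of_forall hK)

/-- The Cauchy-Pompeiu formula at the origin. In polar coordinates
`(∂f/∂z̄) / w · r dr dθ = (∂_r f + (i/r) ∂_θ f) dr dθ / 2`; the radial part integrates to `-π f(0)` and
the angular part to `0`. -/
theorem integral_dzbar_div {f a b : ℂ → ℂ} (h : ∀ w, HasWirtingerAt f (a w) (b w) w)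
    (ha : Continuous a) (hb : Continuous b) {K : ℝ}
    (hfK : ∀ w, ‖f w‖ ≤ K * (1 + ‖w‖ ^ 2)⁻¹) (haK : ∀ w, ‖a w‖ ≤ K * (1 + ‖w‖ ^ 2)⁻¹)
    (hbK : ∀ w, ‖b w‖ ≤ K * (1 + ‖w‖ ^ 2)⁻¹) :
    ∫ w, b w / w = -Real.pi * f 0 := by
  let e : ℝ → ℂ := fun θ => Complex.exp (θ * Complex.I)
  have he : ∀ θ, ‖e θ‖ = 1 := fun θ => Complex.norm_exp_ofReal_mul_I θ
  have hec : Continuous e := by fun_prop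
  have hee : ∀ θ, e θ * conj (e θ) = 1 := by
    intro θ
    rw [Complex.mul_conj, Complex.normSq_eq_norm_sq, he]; simp
  have hn : ∀ (r θ : ℝ), ‖(r : ℂ) * e θ‖ ^ 2 = r ^ 2 := by
    intro r θ
    rw [norm_mul, he, mul_one, Complex.norm_real, Real.norm_eq_abs, sq_abs]
  -- `A + B` is the radial derivative of `f`, and `B - A` is `i / r` times the angular one.
  let A : ℝ × ℝ → ℂ := fun p => a (p.1 * e p.2) * e p.2
  let B : ℝ × ℝ → ℂ := fun p => b (p.1 * e p.2) * conj (e p.2)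
  have hAi := integrable_polar_of_norm_le (u := A) (K := K)
    (by fun_prop) (fun p => by
      simp only [A, norm_mul, he, mul_one]
      rw [← hn p.1 p.2]
      simpa [he] using haK (p.1 * e p.2))
  have hBi := integrable_polar_of_norm_le (u := B) (K := K)
    (by fun_prop) (fun p => by
      simp only [B, norm_mul, RCLike.norm_conj, he, mul_one]
      rw [← hn p.1 p.2]
      simpa [he] using hbK (p.1 * e p.2))
  have hAB := hAi.fun_add hBi
  have hBA : Integrable (fun p => B p - A p) _ := hBi.sub hAi
  have hrad : ∀ θ : ℝ, ∫ r in Set.Ioi (0 : ℝ), (A (r, θ) + B (r, θ)) = - f 0 := by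
    intro θ
    have hd : ∀ r ∈ Set.Ici (0 : ℝ), HasDerivAt (fun r : ℝ => f (r * e θ))
        (A (r, θ) + B (r, θ)) r := by
      intro r _
      have h1 : HasDerivAt (fun r : ℝ => (r : ℂ) * e θ) (1 * e θ) r :=
        (Complex.ofRealCLM.hasDerivAt (x := r)).mul_const (e θ)
      simpa [A, B] using
        HasWirtingerAt.comp_hasDerivAt (γ := fun r : ℝ => (r : ℂ) * e θ) (h (r * e θ)) h1
    have hi : IntegrableOn (fun r : ℝ => A (r, θ) + B (r, θ)) (Set.Ioi 0) := by
      have h2 : Integrable fun r : ℝ => (K + K) * (1 + r ^ 2)⁻¹ :=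
        integrable_inv_one_add_sq.const_mul _
      refine (h2.mono' (by fun_prop) (Filter.Eventually.of_forall fun r => ?_)).integrableOn
      refine (norm_add_le _ _).trans ?_
      rw [add_mul]
      simp only [A, B, norm_mul, RCLike.norm_conj, he, mul_one]
      rw [← hn r θ]
      exact add_le_add (haK _) (hbK _)
    have ht : Filter.Tendsto (fun r : ℝ => f (r * e θ)) Filter.atTop (nhds 0) := by
      have h3 : Filter.Tendsto (fun r : ℝ => K * (1 + r ^ 2)⁻¹) Filter.atTop (nhds 0) := by
        have h4 : Filter.Tendsto (fun r : ℝ => 1 + r ^ 2) Filter.atTop Filter.atTop :=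
          Filter.tendsto_atTop_add_const_left _ _ (Filter.tendsto_pow_atTop two_ne_zero)
        simpa using h4.inv_tendsto_atTop.const_mul K
      refine squeeze_zero_norm (fun r => ?_) h3
      rw [← hn r θ]
      exact hfK _
    rw [integral_Ioi_of_hasDerivAt_of_tendsto' hd hi ht]
    simp
  have hang : ∀ r ∈ Set.Ioi (0 : ℝ),
      ∫ θ in Set.Ioo (-Real.pi) Real.pi, (B (r, θ) - A (r, θ)) = 0 := by
    intro r hr
    have hr0 : (r : ℂ) ≠ 0 := by exact_mod_cast (ne_of_gt hr)
    have hd : ∀ θ ∈ Set.uIcc (-Real.pi) Real.pi, HasDerivAt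
        (fun θ : ℝ => Complex.I / r * f (r * e θ)) (B (r, θ) - A (r, θ)) θ := by
      intro θ _
      have h0 : HasDerivAt (fun θ : ℝ => (θ : ℂ) * Complex.I) (1 * Complex.I) θ :=
        (Complex.ofRealCLM.hasDerivAt (x := θ)).mul_const _
      have h1 : HasDerivAt (fun θ : ℝ => (r : ℂ) * e θ) (r * (e θ * (1 * Complex.I))) θ :=
        (h0.cexp).const_mul _
      refine ((HasWirtingerAt.comp_hasDerivAt (γ := fun θ : ℝ => (r : ℂ) * e θ) (h (r * e θ))
        h1).const_mul (Complex.I / r)).congr_deriv ?_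
      simp only [one_mul, map_mul,
        Complex.conj_ofReal, Complex.conj_I, A, B]
      field_simp
      linear_combination (a (r * e θ) * e θ - b (r * e θ) * conj (e θ)) * Complex.I_sq
    rw [← integral_Ioc_eq_integral_Ioo,
      ← intervalIntegral.integral_of_le (by linarith [Real.pi_pos]),
      intervalIntegral.integral_eq_sub_of_hasDerivAt hd
        (Continuous.intervalIntegrable (by fun_prop) _ _)]
    have : e Real.pi = e (-Real.pi) := by
      simp only [e]
      rw [Complex.exp_pi_mul_I, Complex.ofReal_neg, neg_mul, Complex.exp_neg,
        Complex.exp_pi_mul_I]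
      norm_num
    rw [this, sub_self]
  have hpol : ∫ w, b w / w = ∫ p, B p ∂(((volume : Measure ℝ).restrict (Set.Ioi 0)).prod
      ((volume : Measure ℝ).restrict (Set.Ioo (-Real.pi) Real.pi))) := by
    rw [← Complex.integral_comp_polarCoord_symm, Measure.prod_restrict, ← Measure.volume_eq_prod]
    refine setIntegral_congr_fun (measurableSet_Ioi.prod measurableSet_Ioo) fun p hp => ?_
    have hr0 : (p.1 : ℂ) ≠ 0 := by exact_mod_cast (ne_of_gt hp.1)
    have h5 : Complex.polarCoord.symm p = p.1 * e p.2 := by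
      rw [Complex.polarCoord_symm_apply]
      simp only [e, Complex.exp_mul_I, Complex.ofReal_cos, Complex.ofReal_sin]
    simp only [h5, B, Complex.real_smul]
    have h6 : e p.2 ≠ 0 := Complex.exp_ne_zero _
    field_simp
    linear_combination -b (p.1 * e p.2) * hee p.2
  have hsum : B = fun p => (1 / 2) * (A p + B p) + (1 / 2) * (B p - A p) := by
    funext p; ring
  rw [hpol, congrArg (integral _) hsum]
  rw [integral_add (hAB.const_mul _) (hBA.const_mul _), integral_const_mul, integral_const_mul,
    integral_prod_symm _ hAB, integral_prod _ hBA, setIntegral_congr_fun measurableSet_Ioi hang]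
  simp only [hrad, integral_const]
  rw [measureReal_restrict_apply_univ, Real.volume_real_Ioo_of_le (by linarith [Real.pi_pos])]
  simp only [Complex.real_smul]
  push_cast
  ring

/-- Decay like `(1 + |w|²)⁻¹` survives translations. -/
theorem inv_one_add_sq_add_le (z w : ℂ) :
    (1 + ‖z + w‖ ^ 2)⁻¹ ≤ 2 * (1 + ‖z‖ ^ 2) * (1 + ‖w‖ ^ 2)⁻¹ := by
  rw [← div_eq_mul_inv, inv_eq_one_div, div_le_div_iff₀ (by positivity) (by positivity)]
  have h1 : ‖w‖ ≤ ‖z + w‖ + ‖z‖ := by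
    have := norm_sub_le (z + w) z
    simpa using this
  have h2 : ‖w‖ ^ 2 ≤ (‖z + w‖ + ‖z‖) ^ 2 := by gcongr
  nlinarith [sq_nonneg (‖z + w‖ - ‖z‖), sq_nonneg (‖z + w‖ * ‖z‖)]

/-- The Cauchy-Pompeiu formula on the plane, for functions decaying like the Gaussian. -/
theorem cauchyIntegral_of_dzbar {p a b : ℂ → ℂ} (hp : PolyGrowth p) (ha : PolyGrowth a)
    (hb : PolyGrowth b)
    (h : ∀ z, HasWirtingerAt (fun z => p z * gauss z) (a z * gauss z) (b z * gauss z) z) (z : ℂ) :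
    cauchyIntegral b z = p z * gauss z := by
  obtain ⟨K1, h1, hK1⟩ := hp.norm_mul_gauss_le 1
  obtain ⟨K2, h2, hK2⟩ := ha.norm_mul_gauss_le 1
  obtain ⟨K3, h3, hK3⟩ := hb.norm_mul_gauss_le 1
  have hG := gauss_differentiable.continuous
  have hac := ha.1
  have hbc := hb.1
  have key : ∀ K', 0 ≤ K' → K' ≤ K1 + K2 + K3 → ∀ u : ℂ → ℂ,
      (∀ w, ‖u w‖ ≤ K' * ((1 + ‖w‖ ^ 2) ^ 1)⁻¹) →
      ∀ w, ‖u (z + w)‖ ≤ (K1 + K2 + K3) * (2 * (1 + ‖z‖ ^ 2)) * (1 + ‖w‖ ^ 2)⁻¹ := by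
    intro K' h0 hK' u hu w
    calc ‖u (z + w)‖ ≤ K' * (1 + ‖z + w‖ ^ 2)⁻¹ := by simpa using hu (z + w)
      _ ≤ (K1 + K2 + K3) * (2 * (1 + ‖z‖ ^ 2) * (1 + ‖w‖ ^ 2)⁻¹) :=
        mul_le_mul hK' (inv_one_add_sq_add_le z w) (by positivity) (by positivity)
      _ = _ := by ring
  have main := integral_dzbar_div (f := fun w => p (z + w) * gauss (z + w))
    (a := fun w => a (z + w) * gauss (z + w)) (b := fun w => b (z + w) * gauss (z + w))
    (fun w => (h (z + w)).comp_const_add z)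
    (by fun_prop) (by fun_prop)
    (key K1 h1 (by linarith) (fun w => p w * gauss w) hK1)
    (key K2 h2 (by linarith) (fun w => a w * gauss w) hK2)
    (key K3 h3 (by linarith) (fun w => b w * gauss w) hK3)
  rw [add_zero] at main
  rw [cauchyIntegral, integral_gaussMeasure, ← integral_add_left_eq_self _ z]
  have e : ∀ w, b (z + w) / (z - (z + w)) * gauss (z + w) =
      -(b (z + w) * gauss (z + w) / w) := by
    intro w
    rw [sub_add_cancel_left, div_neg]; ring
  simp only [e]
  rw [integral_neg, main]
  have := Real.pi_ne_zero
  field_simp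

theorem cauchyIntegral_hermitePoly_succ (m n : ℕ) (z : ℂ) :
    cauchyIntegral (hermitePoly (m + 1) n) z = -(hermitePoly m n z * gauss z) := by
  have hH := PolyGrowth.hermitePoly
  have h := cauchyIntegral_of_dzbar (hH m n).neg (hH m (n + 1)) (hH (m + 1) n)
    (fun z => by
      simpa only [neg_mul, neg_neg] using (hasWirtingerAt_hermitePoly_mul_gauss m n z).neg) z
  rw [h, neg_mul]

/-! ### Matrix coefficients of the weighted Cauchy transform -/

/-- Absolute convergence of the double integral `∫∫ f(ξ) g(z) / (z - ξ) dμ(ξ) dμ(z)`. -/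
theorem integrable_cauchy_kernel {f g : ℂ → ℂ} (hf : StronglyMeasurable f)
    (hg : StronglyMeasurable g) (hf2 : MemLp f 2 gaussMeasure) (hg2 : MemLp g 2 gaussMeasure) :
    Integrable (fun p : ℂ × ℂ => f p.2 / (p.1 - p.2) * g p.1)
      (gaussMeasure.prod gaussMeasure) := by
  have hfm := hf.measurable
  have hgm := hg.measurable
  have hf' : Measurable fun p : ℂ × ℂ => f p.2 := hfm.comp measurable_snd
  have hg' : Measurable fun p : ℂ × ℂ => g p.1 := hgm.comp measurable_fst
  have hfin : ∀ {h : ℂ → ℂ}, MemLp h 2 gaussMeasure →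
      ∫⁻ ξ, ‖h ξ‖ₑ ^ (2 : ℝ) ∂gaussMeasure < ⊤ := fun h => by
    simpa using (eLpNorm_lt_top_iff_lintegral_rpow_enorm_lt_top two_ne_zero
      ENNReal.ofNat_ne_top).1 h.2
  have hk : Measurable fun z => ∫⁻ ξ, ‖f ξ / (z - ξ)‖ₑ ∂gaussMeasure :=
    Measurable.lintegral_prod_right' (f := fun p : ℂ × ℂ => ‖f p.2 / (p.1 - p.2)‖ₑ)
      (by fun_prop)
  refine ⟨Measurable.aestronglyMeasurable (by fun_prop), ?_⟩
  rw [HasFiniteIntegral, lintegral_prod _ (by fun_prop)]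
  have e : ∀ z, ∫⁻ ξ, ‖f ξ / (z - ξ) * g z‖ₑ ∂gaussMeasure =
      (∫⁻ ξ, ‖f ξ / (z - ξ)‖ₑ ∂gaussMeasure) * ‖g z‖ₑ := by
    intro z
    simp only [enorm_mul]
    rw [lintegral_mul_const' _ _ enorm_ne_top]
  simp only [e]
  refine (ENNReal.lintegral_mul_le_Lp_mul_Lq gaussMeasure Real.HolderConjugate.two_two
    hk.aemeasurable hgm.enorm.aemeasurable).trans_lt (ENNReal.mul_lt_top ?_ ?_)
  · refine ENNReal.rpow_lt_top_of_nonneg (by norm_num) (ne_of_lt ?_)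
    exact (lintegral_cauchy_sq_le hf).trans_lt
      (ENNReal.mul_lt_top (ENNReal.pow_lt_top kernelBound_lt_top) (hfin hf2))
  · exact ENNReal.rpow_lt_top_of_nonneg (by norm_num) (hfin hg2).ne

/-- The kernel `1 / (z - ξ)` is antisymmetric, hence so is the bilinear form `∫ C(f) g dμ`. -/
theorem integral_cauchyIntegral_mul {f g : ℂ → ℂ} (hf : StronglyMeasurable f)
    (hg : StronglyMeasurable g) (hf2 : MemLp f 2 gaussMeasure) (hg2 : MemLp g 2 gaussMeasure) :
    ∫ z, cauchyIntegral f z * g z ∂gaussMeasure =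
      -∫ z, f z * cauchyIntegral g z ∂gaussMeasure := by
  have h := integral_integral_swap (f := fun z ξ => f ξ / (z - ξ) * g z)
    (integrable_cauchy_kernel hf hg hf2 hg2)
  have e1 : ∀ z, cauchyIntegral f z * g z =
      (1 / (Real.pi : ℂ)) * ∫ ξ, f ξ / (z - ξ) * g z ∂gaussMeasure := by
    intro z
    rw [integral_mul_const, cauchyIntegral, mul_assoc]
  have e2 : ∀ ξ, -(f ξ * cauchyIntegral g ξ) =
      (1 / (Real.pi : ℂ)) * ∫ z, f ξ / (z - ξ) * g z ∂gaussMeasure := by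
    intro ξ
    rw [cauchyIntegral, mul_left_comm, ← integral_const_mul, ← mul_neg, ← integral_neg]
    congr 2
    funext z
    rw [← neg_sub z ξ, div_neg]
    ring
  rw [← integral_neg]
  simp only [e1, e2]
  rw [integral_const_mul, integral_const_mul, h]

theorem integral_mul_left_gaussMeasure {u : ℂ} (hu : ‖u‖ = 1) (f : ℂ → ℂ) :
    ∫ z, f (u * z) ∂gaussMeasure = ∫ z, f z ∂gaussMeasure := by
  let w : Circle := ⟨u, mem_sphere_zero_iff_norm.2 hu⟩
  have h := (rotation w).measurePreserving.integral_comp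
    (rotation w).toHomeomorph.measurableEmbedding (fun z => f z * gauss z)
  rw [integral_gaussMeasure, integral_gaussMeasure, ← h]
  congr 1
  funext z
  have h1 : rotation w z = u * z := rotation_apply w z
  rw [h1]
  simp [gauss, hu]

/-- For antiholomorphic monomials the form `∫ C(f) g dμ` vanishes: rotating by `u` multiplies it by
`ū ^ (l + k + 1)`, which is `-1` for `u = exp (iπ / (l + k + 1))`. -/
theorem integral_cauchyIntegral_conj_pow (l k : ℕ) :
    ∫ z, cauchyIntegral (hermitePoly 0 l) z * hermitePoly 0 k z ∂gaussMeasure = 0 := by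
  let u : ℂ := Complex.exp ((Real.pi / (l + k + 1) : ℝ) * Complex.I)
  have hu : ‖u‖ = 1 := Complex.norm_exp_ofReal_mul_I _
  have hun : u ^ (l + k + 1) = -1 := by
    rw [← Complex.exp_nat_mul, ← Complex.exp_pi_mul_I]
    congr 1
    have : ((l : ℂ) + k + 1) ≠ 0 := by exact_mod_cast Nat.succ_ne_zero (l + k)
    push_cast
    field_simp
  have huc : u * conj u = 1 := by
    rw [Complex.mul_conj, Complex.normSq_eq_norm_sq, hu]; simp
  have hC : ∀ z, cauchyIntegral (hermitePoly 0 l) (u * z) =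
      conj u ^ (l + 1) * cauchyIntegral (hermitePoly 0 l) z := by
    intro z
    rw [cauchyIntegral, ← integral_mul_left_gaussMeasure hu, cauchyIntegral, mul_left_comm,
      ← integral_const_mul (starRingEnd ℂ u ^ (l + 1))]
    congr 2
    funext ξ
    rw [← mul_sub, hermitePoly_zero_left, hermitePoly_zero_left, map_mul, mul_pow,
      div_mul_eq_div_div, div_eq_mul_inv _ u, ← eq_inv_of_mul_eq_one_right huc]
    ring
  have h := integral_mul_left_gaussMeasure hu
    (fun z => cauchyIntegral (hermitePoly 0 l) z * hermitePoly 0 k z)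
  have e : ∀ z, cauchyIntegral (hermitePoly 0 l) (u * z) * hermitePoly 0 k (u * z) =
      -(cauchyIntegral (hermitePoly 0 l) z * hermitePoly 0 k z) := by
    intro z
    have h1 : conj u ^ (l + k + 1) = -1 := by rw [← map_pow, hun]; simp
    rw [hC, hermitePoly_zero_left, hermitePoly_zero_left, map_mul, mul_pow]
    linear_combination cauchyIntegral (hermitePoly 0 l) z * conj z ^ k * h1
  simp only [e] at h
  rw [integral_neg] at h
  linear_combination (-1 / 2) * h

/-- The matrix coefficients of `C`. If `m > 0` the closed form of `C H_{m,l}` applies; if `m = 0 < n`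
antisymmetry reduces to the closed form of `C H_{n,k}`; if `m = n = 0` rotation invariance applies. -/
theorem integral_cauchyIntegral_hermitePoly (m l n k : ℕ) :
    ∫ z, cauchyIntegral (hermitePoly m l) z * hermitePoly n k z ∂gaussMeasure =
      if m + n = l + k + 1 then
        (-1) ^ (m + l) * (-1 / 2) ^ (l + k) * (l + k).factorial * (Real.pi / 2 : ℂ) else 0 := by
  have hH := PolyGrowth.hermitePoly
  rcases m with _ | m
  · rcases n with _ | n
    · rw [integral_cauchyIntegral_conj_pow, if_neg (by omega)]
    · rw [integral_cauchyIntegral_mul (hH 0 l).1.stronglyMeasurable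
        (hH _ _).1.stronglyMeasurable (hH _ _).memLp_two (hH _ _).memLp_two, integral_gaussMeasure]
      simp only [cauchyIntegral_hermitePoly_succ, mul_neg, neg_mul, ← mul_assoc]
      rw [integral_neg, neg_neg, integral_hermitePoly_mul_hermitePoly_gauss_sq,
        integral_hermitePoly_mul_gauss_sq]
      by_cases h : 0 + n = l + k
      · rw [if_pos h, if_pos (by omega), h]
        ring
      · rw [if_neg h, if_neg (by omega), mul_zero]
  · rw [integral_gaussMeasure]
    have e : ∀ z, cauchyIntegral (hermitePoly (m + 1) l) z * hermitePoly n k z * gauss z =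
        -(hermitePoly m l z * hermitePoly n k z * gauss z * gauss z) := by
      intro z
      rw [cauchyIntegral_hermitePoly_succ]; ring
    simp only [e]
    rw [integral_neg, integral_hermitePoly_mul_hermitePoly_gauss_sq,
      integral_hermitePoly_mul_gauss_sq]
    by_cases h : m + n = l + k
    · rw [if_pos h, if_pos (by omega), h]
      ring
    · rw [if_neg h, if_neg (by omega), mul_zero, neg_zero]

/-! ### Ito-Hermite polynomials as vectors, and the Cauchy transform as a bounded operator -/

theorem coeFn_hermiteVec (m n : ℕ) : hermiteVec m n =ᵐ[gaussMeasure] hermitePoly m n := by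
  rw [← itoHermite_eq_hermitePoly]
  exact (itoHermite_memLp m n).coeFn_toLp

theorem inner_hermiteVec (m n : ℕ) (f : GaussL2) :
    inner ℂ (hermiteVec m n) f = ∫ z, f z * hermitePoly n m z ∂gaussMeasure := by
  rw [L2.inner_def]
  refine integral_congr_ae ?_
  filter_upwards [coeFn_hermiteVec m n] with z hz
  rw [hz, RCLike.inner_apply, conj_hermitePoly]

theorem inner_hermiteVec_hermiteVec (m n m' n' : ℕ) :
    inner ℂ (hermiteVec m n) (hermiteVec m' n') =
      if m = m' ∧ n = n' then (Real.pi : ℂ) * m.factorial * n.factorial else 0 := by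
  have h : inner ℂ (hermiteVec m n) (hermiteVec m' n') =
      ∫ z, hermitePoly m' n' z * hermitePoly n m z ∂gaussMeasure := by
    rw [inner_hermiteVec]
    refine integral_congr_ae ?_
    filter_upwards [coeFn_hermiteVec m' n'] with z hz
    rw [hz]
  rw [h, integral_gaussMeasure, integral_hermitePoly_mul_hermitePoly]
  by_cases h : m = m' ∧ n = n'
  · rw [if_pos h, if_pos ⟨h.1.symm, h.2.symm⟩, h.1, h.2]
  · rw [if_neg h, if_neg (by tauto)]

theorem norm_hermiteVec_sq (m n : ℕ) :
    ‖hermiteVec m n‖ ^ 2 = Real.pi * m.factorial * n.factorial := by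
  have h := inner_hermiteVec_hermiteVec m n m n
  rw [if_pos ⟨rfl, rfl⟩, inner_self_eq_norm_sq_to_K] at h
  exact Complex.ofReal_injective (by push_cast; exact h)

theorem hermiteVec_ne_zero (m n : ℕ) : hermiteVec m n ≠ 0 := by
  intro h
  have h1 := norm_hermiteVec_sq m n
  rw [h, norm_zero] at h1
  have : 0 < Real.pi * m.factorial * n.factorial := by
    have := Real.pi_pos
    positivity
  linarith

theorem cauchyIntegral_congr {f g : ℂ → ℂ} (h : f =ᵐ[gaussMeasure] g) :
    cauchyIntegral f = cauchyIntegral g := by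
  funext z
  rw [cauchyIntegral, cauchyIntegral]
  congr 1
  refine integral_congr_ae ?_
  filter_upwards [h] with ξ hξ
  rw [hξ]

theorem coeFn_cauchyTransform (f : GaussL2) :
    cauchyTransform f =ᵐ[gaussMeasure] cauchyIntegral f :=
  (cauchyIntegral_memLp (Lp.stronglyMeasurable f) (Lp.memLp f)).coeFn_toLp

theorem inner_hermiteVec_cauchyTransform (k n m l : ℕ) :
    inner ℂ (hermiteVec k n) (cauchyTransform (hermiteVec m l)) =
      if m + n = l + k + 1 then
        (-1) ^ (m + l) * (-1 / 2) ^ (l + k) * (l + k).factorial * (Real.pi / 2 : ℂ) else 0 := by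
  rw [inner_hermiteVec, ← integral_cauchyIntegral_hermitePoly]
  refine integral_congr_ae ?_
  filter_upwards [coeFn_cauchyTransform (hermiteVec m l)] with z hz
  rw [hz, cauchyIntegral_congr (coeFn_hermiteVec m l)]

theorem norm_cauchyTransform_le (f : GaussL2) :
    ‖cauchyTransform f‖ ≤ kernelBound.toReal * ‖f‖ := by
  have e : ∀ x : ℝ≥0∞, (x ^ (2 : ℝ)) ^ (1 / 2 : ℝ) = x := by
    intro x
    rw [← ENNReal.rpow_mul]
    norm_num
  have h1 : eLpNorm (cauchyTransform f) 2 gaussMeasure ≤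
      kernelBound * eLpNorm f 2 gaussMeasure := by
    rw [eLpNorm_congr_ae (coeFn_cauchyTransform f),
      eLpNorm_eq_lintegral_rpow_enorm_toReal two_ne_zero ENNReal.ofNat_ne_top,
      eLpNorm_eq_lintegral_rpow_enorm_toReal two_ne_zero ENNReal.ofNat_ne_top]
    simp only [ENNReal.toReal_ofNat]
    have h2 : ∫⁻ z, ‖cauchyIntegral f z‖ₑ ^ (2 : ℝ) ∂gaussMeasure ≤
        kernelBound ^ (2 : ℝ) * ∫⁻ ξ, ‖f ξ‖ₑ ^ (2 : ℝ) ∂gaussMeasure := by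
      rw [ENNReal.rpow_two]
      refine le_trans (lintegral_mono fun z => ?_)
        (lintegral_cauchy_sq_le (Lp.stronglyMeasurable f))
      refine ENNReal.rpow_le_rpow ?_ zero_le_two
      rw [cauchyIntegral, enorm_mul]
      refine (mul_le_of_le_one_left zero_le ?_).trans
        (enorm_integral_le_lintegral_enorm (fun ξ => f ξ / (z - ξ)))
      rw [← ofReal_norm]
      refine ENNReal.ofReal_le_one.2 ?_
      rw [norm_div, norm_one, Complex.norm_real, Real.norm_of_nonneg Real.pi_pos.le]
      exact (div_le_one Real.pi_pos).2 (by linarith [Real.pi_gt_three])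
    refine (ENNReal.rpow_le_rpow h2 (by norm_num : (0 : ℝ) ≤ 1 / 2)).trans_eq ?_
    rw [ENNReal.mul_rpow_of_nonneg _ _ (by norm_num), e]
  rw [Lp.norm_def, Lp.norm_def, ← ENNReal.toReal_mul]
  exact ENNReal.toReal_mono (ENNReal.mul_ne_top kernelBound_lt_top.ne (Lp.eLpNorm_ne_top f)) h1

theorem continuous_cauchyTransform : Continuous cauchyTransform :=
  AddMonoidHomClass.continuous_of_bound cauchyTransform _ norm_cauchyTransform_le

/-! ### Completeness of the Ito-Hermite polynomials -/

/-- An integrable real function with vanishing Fourier transform is zero almost everywhere. -/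
theorem ae_eq_zero_of_integral_exp_eq_zero {μ : Measure ℂ} [IsFiniteMeasure μ] {g : ℂ → ℝ}
    (hg : Integrable g μ)
    (h : ∀ w : ℂ, ∫ z, (g z : ℂ) * Complex.exp ((inner ℝ z w : ℝ) * Complex.I) ∂μ = 0) :
    g =ᵐ[μ] 0 := by
  have hfin : ∀ {k : ℂ → ℝ}, Integrable k μ →
      IsFiniteMeasure (μ.withDensity fun z => ENNReal.ofReal (k z)) := fun hk =>
    isFiniteMeasure_withDensity_ofReal hk.2
  have := hfin hg
  have := hfin hg.neg
  have hchar : ∀ {k : ℂ → ℝ}, Integrable k μ → ∀ w,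
      charFun (μ.withDensity fun z => ENNReal.ofReal (k z)) w =
        ∫ z, ((max (k z) 0 : ℝ) : ℂ) * Complex.exp ((inner ℝ z w : ℝ) * Complex.I) ∂μ := by
    intro k hk w
    rw [charFun_apply, integral_withDensity_eq_integral_toReal_smul₀
      hk.1.aemeasurable.ennreal_ofReal (Filter.Eventually.of_forall fun _ => ENNReal.ofReal_lt_top)]
    simp only [ENNReal.toReal_ofReal', Complex.real_smul]
  have hi : ∀ {k : ℂ → ℝ}, Integrable k μ → ∀ w : ℂ, Integrable (fun z =>
      ((max (k z) 0 : ℝ) : ℂ) * Complex.exp ((inner ℝ z w : ℝ) * Complex.I)) μ := by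
    intro k hk w
    refine hk.pos_part.ofReal.mul_bdd (c := 1) ?_ (Filter.Eventually.of_forall fun z => ?_)
    · exact Continuous.aestronglyMeasurable (by fun_prop)
    · rw [Complex.norm_exp_ofReal_mul_I]
  -- The positive and the negative part of `g` have the same characteristic function.
  have heq : (μ.withDensity fun z => ENNReal.ofReal (g z)) =
      μ.withDensity fun z => ENNReal.ofReal ((-g) z) := by
    refine Measure.ext_of_charFun (funext fun w => ?_)
    rw [hchar hg, hchar hg.neg, ← sub_eq_zero, ← integral_sub (hi hg w) (hi hg.neg w), ← h w]
    refine integral_congr_ae (Filter.Eventually.of_forall fun z => ?_)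
    simp only [← sub_mul, ← Complex.ofReal_sub, Pi.neg_apply]
    rcases le_total 0 (g z) with h0 | h0
    · simp [h0]
    · simp [h0]
  rw [withDensity_eq_iff_of_sigmaFinite hg.1.aemeasurable.ennreal_ofReal
    hg.neg.1.aemeasurable.ennreal_ofReal] at heq
  filter_upwards [heq] with z hz
  rcases lt_trichotomy (g z) 0 with h0 | h0 | h0
  · rw [ENNReal.ofReal_of_nonpos h0.le, eq_comm, ENNReal.ofReal_eq_zero] at hz
    simp only [Pi.neg_apply] at hz
    simp only [Pi.zero_apply]; linarith
  · simpa using h0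
  · rw [Pi.neg_apply, ENNReal.ofReal_of_nonpos (p := -g z) (by linarith),
      ENNReal.ofReal_eq_zero] at hz
    simp only [Pi.zero_apply]; linarith

/-- The linear span of the Ito-Hermite polynomials, as functions. -/
def hermiteSpan : Submodule ℂ (ℂ → ℂ) :=
  Submodule.span ℂ (Set.range fun p : ℕ × ℕ => hermitePoly p.1 p.2)

theorem hermitePoly_mem (m n : ℕ) : hermitePoly m n ∈ hermiteSpan :=
  Submodule.subset_span ⟨(m, n), rfl⟩

/-- By the recursions, the span is stable under multiplication by `z` and `z̄`, so that it contains all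
polynomials in `z` and `z̄`. -/
theorem id_mul_mem_hermiteSpan {p : ℂ → ℂ} (hp : p ∈ hermiteSpan) :
    (fun z => z * p z) ∈ hermiteSpan ∧ (fun z => conj z * p z) ∈ hermiteSpan := by
  induction hp using Submodule.span_induction with
  | mem f h =>
    obtain ⟨⟨m, n⟩, rfl⟩ := h
    constructor
    · have e : (fun z => z * hermitePoly m n z) =
          hermitePoly (m + 1) n + (n : ℂ) • hermitePoly m (n - 1) := by
        funext z
        simp [hermitePoly_succ_left]
      simp only
      rw [e]
      exact hermiteSpan.add_mem (hermitePoly_mem _ _)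
        (hermiteSpan.smul_mem _ (hermitePoly_mem _ _))
    · have e : (fun z => conj z * hermitePoly m n z) =
          hermitePoly m (n + 1) + (m : ℂ) • hermitePoly (m - 1) n := by
        funext z
        simp [hermitePoly_succ_right]
      simp only
      rw [e]
      exact hermiteSpan.add_mem (hermitePoly_mem _ _)
        (hermiteSpan.smul_mem _ (hermitePoly_mem _ _))
  | zero =>
    simp only [Pi.zero_apply, mul_zero]
    exact ⟨hermiteSpan.zero_mem, hermiteSpan.zero_mem⟩
  | add f g _ _ hf hg =>
    simp only [Pi.add_apply, mul_add]
    exact ⟨hermiteSpan.add_mem hf.1 hg.1, hermiteSpan.add_mem hf.2 hg.2⟩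
  | smul c f _ hf =>
    simp only [Pi.smul_apply, smul_eq_mul, mul_left_comm _ c]
    exact ⟨hermiteSpan.smul_mem c hf.1, hermiteSpan.smul_mem c hf.2⟩

theorem inner_pow_mem_hermiteSpan (w : ℂ) (k : ℕ) :
    (fun z : ℂ => ((inner ℝ z w : ℝ) : ℂ) ^ k) ∈ hermiteSpan := by
  induction k with
  | zero => simpa [hermitePoly] using hermitePoly_mem 0 0
  | succ k ih =>
    have h := id_mul_mem_hermiteSpan ih
    have e : (fun z : ℂ => ((inner ℝ z w : ℝ) : ℂ) ^ (k + 1)) =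
        (conj w / 2) • (fun z : ℂ => z * ((inner ℝ z w : ℝ) : ℂ) ^ k) +
          (w / 2) • (fun z : ℂ => conj z * ((inner ℝ z w : ℝ) : ℂ) ^ k) := by
      funext z
      have h1 : ((inner ℝ z w : ℝ) : ℂ) = (conj w * z + w * conj z) / 2 := by
        rw [Complex.inner, Complex.re_eq_add_conj]
        simp
        ring
      simp only [Pi.add_apply, Pi.smul_apply, smul_eq_mul, pow_succ]
      linear_combination ((inner ℝ z w : ℝ) : ℂ) ^ k * h1
    rw [e]
    exact hermiteSpan.add_mem (hermiteSpan.smul_mem _ h.1) (hermiteSpan.smul_mem _ h.2)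

theorem integrable_mul_of_polyGrowth (f : GaussL2) {p : ℂ → ℂ} (hp : PolyGrowth p) :
    Integrable (fun z => f z * p z) gaussMeasure :=
  MemLp.integrable_mul (Lp.memLp f) hp.memLp_two

theorem integral_mul_eq_zero_of_mem_hermiteSpan {f : GaussL2}
    (hf : ∀ m n, inner ℂ (hermiteVec m n) f = 0) {p : ℂ → ℂ} (hp : p ∈ hermiteSpan) :
    Integrable (fun z => f z * p z) gaussMeasure ∧ ∫ z, f z * p z ∂gaussMeasure = 0 := by
  induction hp using Submodule.span_induction with
  | mem q h =>
    obtain ⟨⟨m, n⟩, rfl⟩ := h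
    exact ⟨integrable_mul_of_polyGrowth f (PolyGrowth.hermitePoly m n),
      by rw [← inner_hermiteVec, hf]⟩
  | zero => simp
  | add q r _ _ hq hr =>
    simp only [Pi.add_apply, mul_add]
    exact ⟨hq.1.add hr.1, by rw [integral_add hq.1 hr.1, hq.2, hr.2, add_zero]⟩
  | smul c q _ hq =>
    simp only [Pi.smul_apply, smul_eq_mul, mul_left_comm _ c]
    exact ⟨hq.1.const_mul c, by rw [integral_const_mul, hq.2, mul_zero]⟩

theorem memLp_exp_mul_norm (c : ℝ) :
    MemLp (fun z : ℂ => Real.exp (c * ‖z‖)) 2 gaussMeasure := by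
  rw [memLp_two_iff_integrable_sq (Continuous.aestronglyMeasurable (by fun_prop)),
    integrable_gauss_iff]
  have h1 : Integrable fun z : ℂ => Real.exp (-(1 / 2) * ‖z‖ ^ (2 : ℝ)) := by
    refine Integrable.of_integral_ne_zero ?_
    rw [Complex.integral_exp_neg_mul_rpow (by norm_num) (by norm_num)]
    have := Real.Gamma_pos_of_pos (s := 2 / 2 + 1) (by norm_num)
    have := Real.pi_pos
    positivity
  refine (h1.const_mul (Real.exp (2 * c ^ 2))).mono'
    (Continuous.aestronglyMeasurable (by fun_prop)) (Filter.Eventually.of_forall fun z => ?_)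
  rw [← Real.exp_nat_mul, ← Real.exp_add, ← Real.exp_add, Real.norm_of_nonneg (Real.exp_pos _).le,
    Real.rpow_two]
  refine Real.exp_le_exp.2 ?_
  push_cast
  nlinarith [sq_nonneg (2 * c - ‖z‖)]

/-- Expanding the exponential into its power series, orthogonality to all polynomials implies that
the Fourier transform of `f` against the Gaussian measure vanishes. -/
theorem integral_mul_exp_eq_zero {f : GaussL2} (hf : ∀ m n, inner ℂ (hermiteVec m n) f = 0)
    (w : ℂ) :
    ∫ z, f z * Complex.exp ((inner ℝ z w : ℝ) * Complex.I) ∂gaussMeasure = 0 := by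
  let F : ℕ → ℂ → ℂ := fun k z =>
    f z * ((k.factorial : ℂ)⁻¹ * (((inner ℝ z w : ℝ) : ℂ) * Complex.I) ^ k)
  have hsum : ∀ x : ℝ, HasSum (fun k : ℕ => (k.factorial : ℝ)⁻¹ * x ^ k) (Real.exp x) := by
    intro x
    have := NormedSpace.expSeries_div_hasSum_exp (𝔸 := ℝ) x
    rw [← Real.exp_eq_exp_ℝ] at this
    simpa [div_eq_inv_mul] using this
  have hsumC : ∀ x : ℂ, HasSum (fun k : ℕ => (k.factorial : ℂ)⁻¹ * x ^ k) (Complex.exp x) := by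
    intro x
    have := NormedSpace.expSeries_div_hasSum_exp (𝔸 := ℂ) x
    rw [← Complex.exp_eq_exp_ℂ] at this
    simpa [div_eq_inv_mul] using this
  have hin : ∀ z : ℂ, |(inner ℝ z w : ℝ)| ≤ ‖w‖ * ‖z‖ := fun z => by
    rw [mul_comm]; exact abs_real_inner_le_norm z w
  have hmeas : ∀ k, AEStronglyMeasurable (F k) gaussMeasure := by
    intro k
    refine (Lp.aestronglyMeasurable f).mul (Continuous.aestronglyMeasurable ?_)
    fun_prop
  have h0 : ∀ k, ∫ z, F k z ∂gaussMeasure = 0 := by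
    intro k
    have h1 := (integral_mul_eq_zero_of_mem_hermiteSpan hf (inner_pow_mem_hermiteSpan w k)).2
    have h2 : ∀ z, F k z = ((k.factorial : ℂ)⁻¹ * Complex.I ^ k) *
        (f z * ((inner ℝ z w : ℝ) : ℂ) ^ k) := by
      intro z
      simp only [F, mul_pow]; ring
    simp only [h2]
    rw [integral_const_mul, h1, mul_zero]
  have h := hasSum_integral_of_dominated_convergence (μ := gaussMeasure) (F := F)
    (f := fun z => f z * Complex.exp ((inner ℝ z w : ℝ) * Complex.I))
    (bound := fun k z => ‖f z‖ * ((k.factorial : ℝ)⁻¹ * (‖w‖ * ‖z‖) ^ k)) hmeas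
    (fun k => Filter.Eventually.of_forall fun z => ?_)
    (Filter.Eventually.of_forall fun z => ((hsum _).mul_left _).summable) ?_
    (Filter.Eventually.of_forall fun z => (hsumC _).mul_left _)
  · simp only [h0] at h
    exact h.unique hasSum_zero
  · simp only [F, norm_mul, norm_inv, norm_pow, Complex.norm_I, mul_one, Complex.norm_real,
      Real.norm_eq_abs, Complex.norm_natCast]
    gcongr
    exact hin z
  · simp only [tsum_mul_left, (hsum _).tsum_eq]
    exact MemLp.integrable_mul (Lp.memLp f).norm (memLp_exp_mul_norm ‖w‖)

/-- The Ito-Hermite polynomials are complete in the Gaussian Hilbert space. -/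
theorem eq_zero_of_inner_hermiteVec_eq_zero {f : GaussL2}
    (hf : ∀ m n, inner ℂ (hermiteVec m n) f = 0) : f = 0 := by
  have hfi : Integrable f gaussMeasure := (Lp.memLp f).integrable one_le_two
  have hexp : ∀ w : ℂ, Integrable
      (fun z => f z * Complex.exp ((inner ℝ z w : ℝ) * Complex.I)) gaussMeasure := by
    intro w
    refine hfi.mul_bdd (c := 1) ?_ (Filter.Eventually.of_forall fun z => ?_)
    · exact Continuous.aestronglyMeasurable (by fun_prop)
    · rw [Complex.norm_exp_ofReal_mul_I]
  have hconj : ∀ (w z : ℂ), conj (f z * Complex.exp ((inner ℝ z (-w) : ℝ) * Complex.I)) =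
      conj (f z) * Complex.exp ((inner ℝ z w : ℝ) * Complex.I) := by
    intro w z
    rw [map_mul, ← Complex.exp_conj, map_mul, Complex.conj_ofReal, Complex.conj_I, inner_neg_right]
    congr 2
    push_cast; ring
  have hexp' : ∀ w : ℂ, Integrable
      (fun z => conj (f z) * Complex.exp ((inner ℝ z w : ℝ) * Complex.I)) gaussMeasure := by
    intro w
    simp only [← hconj]
    exact (Complex.conjCLE : ℂ →L[ℝ] ℂ).integrable_comp (hexp (-w))
  have h1 := integral_mul_exp_eq_zero hf
  have h2 : ∀ w : ℂ, ∫ z, conj (f z) * Complex.exp ((inner ℝ z w : ℝ) * Complex.I)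
      ∂gaussMeasure = 0 := by
    intro w
    simp only [← hconj]
    rw [integral_conj, h1, map_zero]
  have hre : (fun z => (f z).re) =ᵐ[gaussMeasure] 0 := by
    refine ae_eq_zero_of_integral_exp_eq_zero hfi.re fun w => ?_
    have e : ∀ z, ((f z).re : ℂ) * Complex.exp ((inner ℝ z w : ℝ) * Complex.I) =
        (1 / 2) * (f z * Complex.exp ((inner ℝ z w : ℝ) * Complex.I) +
          conj (f z) * Complex.exp ((inner ℝ z w : ℝ) * Complex.I)) := by
      intro z
      rw [Complex.re_eq_add_conj]; ring
    simp only [e]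
    rw [integral_const_mul, integral_add (hexp w) (hexp' w), h1, h2]
    simp
  have him : (fun z => (f z).im) =ᵐ[gaussMeasure] 0 := by
    refine ae_eq_zero_of_integral_exp_eq_zero hfi.im fun w => ?_
    have e : ∀ z, ((f z).im : ℂ) * Complex.exp ((inner ℝ z w : ℝ) * Complex.I) =
        (1 / (2 * Complex.I)) * (f z * Complex.exp ((inner ℝ z w : ℝ) * Complex.I) -
          conj (f z) * Complex.exp ((inner ℝ z w : ℝ) * Complex.I)) := by
      intro z
      rw [Complex.im_eq_sub_conj]; ring
    simp only [e]
    rw [integral_const_mul, integral_sub (hexp w) (hexp' w), h1, h2]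
    simp
  rw [Lp.eq_zero_iff_ae_eq_zero]
  filter_upwards [hre, him] with z hz1 hz2
  exact Complex.ext hz1 hz2

/-! ### Test functions and the Landau operator -/

/-- Smooth compactly supported functions on the plane. -/
def IsTestFunction (φ : ℂ → ℂ) : Prop := ContDiff ℝ ∞ φ ∧ HasCompactSupport φ

namespace IsTestFunction

variable {φ : ℂ → ℂ}

theorem dz (h : IsTestFunction φ) : IsTestFunction (dz φ) := by
  have h3 : ContDiff ℝ ∞ (fderiv ℝ φ) := h.1.fderiv_right (by norm_cast)
  refine ⟨?_, (h.2.fderiv ℝ).comp_left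
    (g := fun L : ℂ →L[ℝ] ℂ => (1 / 2) * (L 1 - Complex.I * L Complex.I)) (by simp)⟩
  unfold WeightedCauchy.dz; fun_prop

theorem dzbar (h : IsTestFunction φ) : IsTestFunction (dzbar φ) := by
  have h3 : ContDiff ℝ ∞ (fderiv ℝ φ) := h.1.fderiv_right (by norm_cast)
  refine ⟨?_, (h.2.fderiv ℝ).comp_left
    (g := fun L : ℂ →L[ℝ] ℂ => (1 / 2) * (L 1 + Complex.I * L Complex.I)) (by simp)⟩
  unfold WeightedCauchy.dzbar; fun_prop

theorem hasWirtingerAt (h : IsTestFunction φ) (z : ℂ) :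
    HasWirtingerAt φ (WeightedCauchy.dz φ z) (WeightedCauchy.dzbar φ z) z :=
  HasWirtingerAt.of_differentiableAt (h.1.differentiable (by simp) z)

theorem integrable_mul_conj (h : IsTestFunction φ) {p : ℂ → ℂ} (hp : Continuous p) :
    Integrable fun z => p z * conj (φ z) := by
  have := h.1.continuous
  refine Continuous.integrable_of_hasCompactSupport (by fun_prop) ?_
  exact (h.2.comp_left (g := fun w => conj w) (map_zero _)).mul_left

theorem exists_bound (h : IsTestFunction φ) : ∃ M, 0 ≤ M ∧ ∀ z, ‖φ z‖ ≤ M := by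
  obtain ⟨M, hM⟩ := h.2.exists_bound_of_continuous h.1.continuous
  exact ⟨M, (norm_nonneg _).trans (hM 0), hM⟩

end IsTestFunction

/-- `H_{m,n}` is an eigenfunction of the Landau operator for the eigenvalue `n`. -/
theorem hermiteVec_mem_bargmann (m n : ℕ) : hermiteVec m n ∈ bargmann n := by
  intro φ hφ hc
  have ht : IsTestFunction φ := ⟨hφ, hc⟩
  have hG := gauss_differentiable.continuous
  have hH : ∀ m n, Continuous (hermitePoly m n) := fun m n => (PolyGrowth.hermitePoly m n).1
  -- Two integrations by parts, the first with `∂_z̄` and the second with `∂_z`.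
  have h1 := (integral_wirtinger_eq_zero
    (f := fun z => hermitePoly m n z * gauss z * conj (dzbar φ z))
    (a := fun z => -hermitePoly m (n + 1) z * gauss z * conj (dzbar φ z) +
      hermitePoly m n z * gauss z * conj (dzbar (dzbar φ) z))
    (b := fun z => hermitePoly m n z * gauss z * conj (dz (dzbar φ) z) -
      hermitePoly (m + 1) n z * gauss z * conj (dzbar φ z))
    (fun z => ((hasWirtingerAt_hermitePoly_mul_gauss m n z).mul
      (ht.dzbar.hasWirtingerAt z).conjugate).congr rfl (by ring))
    (ht.dzbar.integrable_mul_conj (by fun_prop))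
    ((ht.dzbar.integrable_mul_conj (p := fun z => -hermitePoly m (n + 1) z * gauss z)
      (by fun_prop)).add (ht.dzbar.dzbar.integrable_mul_conj (by fun_prop)))
    ((ht.dzbar.dz.integrable_mul_conj (by fun_prop)).sub
      (ht.dzbar.integrable_mul_conj (by fun_prop)))).2
  have h2 := (integral_wirtinger_eq_zero
    (f := fun z => hermitePoly m (n - 1) z * gauss z * conj (φ z))
    (a := fun z => hermitePoly m (n - 1) z * gauss z * conj (dzbar φ z) -
      hermitePoly m (n - 1 + 1) z * gauss z * conj (φ z))
    (b := fun z => -hermitePoly (m + 1) (n - 1) z * gauss z * conj (φ z) +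
      hermitePoly m (n - 1) z * gauss z * conj (dz φ z))
    (fun z => ((hasWirtingerAt_hermitePoly_mul_gauss m (n - 1) z).mul
      (ht.hasWirtingerAt z).conjugate).congr (by ring) rfl)
    (ht.integrable_mul_conj (by fun_prop))
    ((ht.dzbar.integrable_mul_conj (by fun_prop)).sub (ht.integrable_mul_conj (by fun_prop)))
    ((ht.integrable_mul_conj (p := fun z => -hermitePoly (m + 1) (n - 1) z * gauss z)
      (by fun_prop)).add (ht.dz.integrable_mul_conj (by fun_prop)))).1
  have hcongr : ∫ z, hermiteVec m n z * conj (landau φ z - n * φ z) ∂gaussMeasure =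
      ∫ z, hermitePoly m n z * conj (landau φ z - n * φ z) ∂gaussMeasure := by
    refine integral_congr_ae ?_
    filter_upwards [coeFn_hermiteVec m n] with z hz
    rw [hz]
  have e : ∀ z, hermitePoly m n z * conj (landau φ z - n * φ z) * gauss z =
      n * (hermitePoly m (n - 1) z * gauss z * conj (dzbar φ z) -
        hermitePoly m (n - 1 + 1) z * gauss z * conj (φ z)) -
      (hermitePoly m n z * gauss z * conj (dz (dzbar φ) z) -
        hermitePoly (m + 1) n z * gauss z * conj (dzbar φ z)) := by
    intro z
    have h3 : (n : ℂ) * hermitePoly m (n - 1 + 1) z = n * hermitePoly m n z := by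
      rcases n with _ | n
      · simp
      · simp
    rw [landau, hermitePoly_succ_left]
    simp only [map_sub, map_add, map_neg, map_mul, Complex.conj_conj, map_natCast]
    linear_combination gauss z * conj (φ z) * h3
  rw [hcongr, integral_gaussMeasure]
  simp only [e]
  rw [integral_sub, integral_const_mul, h1, h2]
  · simp
  · exact ((ht.dzbar.integrable_mul_conj (by fun_prop)).sub
      (ht.integrable_mul_conj (by fun_prop))).const_mul _
  · exact (ht.dzbar.dz.integrable_mul_conj (by fun_prop)).sub
      (ht.dzbar.integrable_mul_conj (by fun_prop))

theorem HasWirtingerAt.comp_real_mul {f : ℂ → ℂ} {a b z : ℂ} (s : ℝ)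
    (h : HasWirtingerAt f a b (s * z)) :
    HasWirtingerAt (fun z => f (s * z)) (s * a) (s * b) z := by
  have h1 : HasFDerivAt (fun z : ℂ => (s : ℂ) * z) ((s : ℂ) • ContinuousLinearMap.id ℝ ℂ) z :=
    (hasFDerivAt_id z).const_mul (s : ℂ)
  refine HasFDerivAt.congr_fderiv (HasFDerivAt.comp z (f := fun z : ℂ => (s : ℂ) * z) (g := f)
    (show HasFDerivAt f _ (s * z) from h) h1) ?_
  ext v
  simp
  ring

theorem contDiff_hermitePoly (m n : ℕ) : ContDiff ℝ ∞ (hermitePoly m n) := by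
  have hc : ContDiff ℝ ∞ (fun z : ℂ => conj z) := Complex.conjCLE.contDiff
  induction m generalizing n with
  | zero => exact hc.pow n
  | succ m ih => exact (contDiff_id.mul (ih n)).sub (contDiff_const.mul (ih (n - 1)))

/-- Testing the weak equation `Δ f = n f` against `H_{m,k}` multiplied by smooth cutoffs shows that
an eigenfunction is orthogonal to the eigenfunctions for the other eigenvalues. -/
theorem inner_hermiteVec_eq_zero_of_mem_bargmann {n : ℕ} {f : GaussL2} (hf : f ∈ bargmann n)
    (m : ℕ) {k : ℕ} (hk : k ≠ n) : inner ℂ (hermiteVec m k) f = 0 := by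
  let χ : ContDiffBump (0 : ℂ) := ⟨1, 2, one_pos, one_lt_two⟩
  let c : ℂ → ℂ := fun z => (χ z : ℂ)
  have hc : IsTestFunction c := ⟨Complex.ofRealCLM.contDiff.comp χ.contDiff,
    χ.hasCompactSupport.comp_left (g := fun x : ℝ => (x : ℂ)) Complex.ofReal_zero⟩
  have hc0 : c 0 = 1 := by
    simp only [c]
    rw [χ.one_of_mem_closedBall (by simp [χ])]
    simp
  obtain ⟨M1, hM1, hb1⟩ := hc.exists_bound
  obtain ⟨M2, hM2, hb2⟩ := hc.dz.exists_bound
  obtain ⟨M3, hM3, hb3⟩ := hc.dzbar.exists_bound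
  obtain ⟨M4, hM4, hb4⟩ := hc.dzbar.dz.exists_bound
  let s : ℕ → ℝ := fun j => 1 / ((j : ℝ) + 1)
  have hs0 : ∀ j, 0 < s j := fun j => by positivity
  have hs1 : ∀ j, s j ≤ 1 := fun j => by
    simp only [s]
    rw [div_le_one (by positivity)]
    linarith [(Nat.cast_nonneg j : (0 : ℝ) ≤ j)]
  have hst : Filter.Tendsto s Filter.atTop (nhds 0) := tendsto_one_div_add_atTop_nhds_zero_nat
  let H := hermitePoly m k
  let H1 : ℂ → ℂ := fun z => m * hermitePoly (m - 1) k z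
  let H2 : ℂ → ℂ := fun z => k * hermitePoly m (k - 1) z
  let E : ℕ → ℂ → ℂ := fun j z => -(s j * dz (dzbar c) (s j * z) * H z) -
    dzbar c (s j * z) * H1 z - dz c (s j * z) * H2 z + dzbar c (s j * z) * (conj z * H z)
  -- `u j` is `(Δ - n)` applied to `c (s j z) H_{m,k}`, and `s j * E j` collects the terms in which the
  -- cutoff is differentiated; every such derivative brings a factor `s j`.
  let u : ℕ → ℂ → ℂ := fun j z => c (s j * z) * (((k : ℂ) - n) * H z) + s j * E j z
  have htest : ∀ j, IsTestFunction fun z => c (s j * z) * H z := by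
    intro j
    have hcomp : IsTestFunction fun z => c (s j * z) := by
      refine ⟨hc.1.comp (contDiff_const.mul contDiff_id), ?_⟩
      have h0 : (s j : ℂ) ≠ 0 := by exact_mod_cast (hs0 j).ne'
      exact hc.2.comp_homeomorph (Homeomorph.mulLeft₀ (s j : ℂ) h0)
    exact ⟨hcomp.1.mul (contDiff_hermitePoly m k), hcomp.2.mul_right⟩
  have hlandau : ∀ j z, landau (fun z => c (s j * z) * H z) z - n * (c (s j * z) * H z) =
      u j z := by
    intro j z
    have hw : ∀ z, HasWirtingerAt (fun z => c (s j * z)) _ _ z := fun z =>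
      (hc.hasWirtingerAt (s j * z)).comp_real_mul
    have hwb : ∀ z, HasWirtingerAt (fun z => dzbar c (s j * z)) _ _ z := fun z =>
      (hc.dzbar.hasWirtingerAt (s j * z)).comp_real_mul
    have hd : dzbar (fun z => c (s j * z) * H z) = fun z =>
        s j * dzbar c (s j * z) * H z + c (s j * z) * (k * hermitePoly m (k - 1) z) := by
      funext z
      exact ((hw z).mul (hasWirtingerAt_hermitePoly m k z)).dzbar_eq
    have hdd := ((((hwb z).const_mul (s j)).mul (hasWirtingerAt_hermitePoly m k z)).add
      ((hw z).mul ((hasWirtingerAt_hermitePoly m (k - 1) z).const_mul k))).dz_eq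
    rw [landau, hd, hdd]
    have h3 : (k : ℂ) * H z = k * (conj z * hermitePoly m (k - 1) z -
        m * hermitePoly (m - 1) (k - 1) z) := by
      rcases k with _ | k
      · simp
      · rw [← hermitePoly_succ_right]; simp [H]
    simp only [u, E, H1, H2]
    linear_combination -c (s j * z) * h3
  have hzero : ∀ j, ∫ z, f z * conj (u j z) ∂gaussMeasure = 0 := by
    intro j
    have h := hf _ (htest j).1 (htest j).2
    simpa only [hlandau] using h
  have hHp := PolyGrowth.hermitePoly m k
  have hH1p : PolyGrowth H1 := (PolyGrowth.const _).mul (PolyGrowth.hermitePoly _ _)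
  have hH2p : PolyGrowth H2 := (PolyGrowth.const _).mul (PolyGrowth.hermitePoly _ _)
  let bound : ℂ → ℝ := fun z => M1 * ‖f z * (((k : ℂ) - n) * H z)‖ + (M4 * ‖f z * H z‖ +
    M3 * ‖f z * H1 z‖ + M2 * ‖f z * H2 z‖ + M3 * ‖f z * (conj z * H z)‖)
  have hbi : Integrable bound gaussMeasure := by
    have hp := fun {p : ℂ → ℂ} (hp : PolyGrowth p) => (integrable_mul_of_polyGrowth f hp).norm
    exact ((hp ((PolyGrowth.const _).mul hHp)).const_mul _).add
      (((((hp hHp).const_mul _).add ((hp hH1p).const_mul _)).add ((hp hH2p).const_mul _)).add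
        ((hp (PolyGrowth.id.conjugate.mul hHp)).const_mul _))
  have hE : ∀ j z, ‖E j z‖ ≤ M4 * ‖H z‖ + M3 * ‖H1 z‖ + M2 * ‖H2 z‖ + M3 * ‖conj z * H z‖ := by
    intro j z
    refine (norm_add_le _ _).trans (add_le_add ((norm_sub_le _ _).trans (add_le_add
      ((norm_sub_le _ _).trans (add_le_add ?_ ?_)) ?_)) ?_)
    · rw [norm_neg, norm_mul, norm_mul, Complex.norm_real, Real.norm_of_nonneg (hs0 j).le]
      gcongr
      calc s j * ‖dz (dzbar c) (s j * z)‖ ≤ 1 * M4 :=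
            mul_le_mul (hs1 j) (hb4 _) (norm_nonneg _) zero_le_one
        _ = M4 := one_mul _
    · rw [norm_mul]; gcongr; exact hb3 _
    · rw [norm_mul]; gcongr; exact hb2 _
    · rw [norm_mul]; gcongr; exact hb3 _
  have hcont : ∀ j, Continuous (u j) := by
    intro j
    have h1 := hc.1.continuous
    have h2 := hc.dz.1.continuous
    have h3 := hc.dzbar.1.continuous
    have h4 := hc.dzbar.dz.1.continuous
    have h5 := hHp.1
    have h6 := hH1p.1
    have h7 := hH2p.1
    simp only [u, E, H]
    fun_prop
  have hlim := tendsto_integral_of_dominated_convergence (μ := gaussMeasure)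
    (F := fun j z => f z * conj (u j z)) (f := fun z => f z * conj (((k : ℂ) - n) * H z)) bound
    (fun j => (Lp.aestronglyMeasurable f).mul
      (Complex.continuous_conj.comp (hcont j)).aestronglyMeasurable) hbi
    (fun j => Filter.Eventually.of_forall fun z => ?_) (Filter.Eventually.of_forall fun z => ?_)
  · simp only [hzero] at hlim
    have h0 := tendsto_nhds_unique hlim tendsto_const_nhds
    have e : ∀ z, f z * conj (((k : ℂ) - n) * H z) =
        ((k : ℂ) - n) * (f z * hermitePoly k m z) := by
      intro z
      simp only [H, map_mul, map_sub, map_natCast, conj_hermitePoly]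
      ring
    simp only [e] at h0
    rw [integral_const_mul] at h0
    rw [inner_hermiteVec]
    refine (mul_eq_zero.1 h0).resolve_left (sub_ne_zero.2 ?_)
    exact_mod_cast hk
  · have h1 : ‖u j z‖ ≤ M1 * ‖((k : ℂ) - n) * H z‖ + (M4 * ‖H z‖ + M3 * ‖H1 z‖ + M2 * ‖H2 z‖ +
        M3 * ‖conj z * H z‖) := by
      refine (norm_add_le _ _).trans (add_le_add ?_ ?_)
      · rw [norm_mul]; gcongr; exact hb1 _
      · rw [norm_mul, Complex.norm_real, Real.norm_of_nonneg (hs0 j).le]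
        exact (mul_le_of_le_one_left (norm_nonneg _) (hs1 j)).trans (hE j z)
    rw [norm_mul, RCLike.norm_conj]
    refine (mul_le_mul_of_nonneg_left h1 (norm_nonneg (f z))).trans_eq ?_
    simp only [bound, norm_mul]
    ring
  · have h1 : Filter.Tendsto (fun j => c (s j * z)) Filter.atTop (nhds 1) := by
      rw [← hc0]
      refine (hc.1.continuous.tendsto 0).comp ?_
      have : Filter.Tendsto (fun j => (s j : ℂ) * z) Filter.atTop (nhds ((0 : ℝ) * z)) :=
        ((Complex.continuous_ofReal.tendsto 0).comp hst).mul_const z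
      simpa using this
    have h2 : Filter.Tendsto (fun j => (s j : ℂ) * E j z) Filter.atTop (nhds 0) := by
      refine squeeze_zero_norm (a := fun j => s j * (M4 * ‖H z‖ + M3 * ‖H1 z‖ + M2 * ‖H2 z‖ +
        M3 * ‖conj z * H z‖)) (fun j => ?_) (by simpa using hst.mul_const _)
      rw [norm_mul, Complex.norm_real, Real.norm_of_nonneg (hs0 j).le]
      exact mul_le_mul_of_nonneg_left (hE j z) (hs0 j).le
    have h3 := (h1.mul_const (((k : ℂ) - n) * H z)).add h2
    rw [one_mul, add_zero] at h3
    exact ((Complex.continuous_conj.tendsto _).comp h3).const_mul (f z)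

/-! ### Expansions in Ito-Hermite polynomials -/

/-- The normalized Ito-Hermite polynomials. -/
noncomputable def hermiteUnit (p : ℕ × ℕ) : GaussL2 :=
  ((‖hermiteVec p.1 p.2‖⁻¹ : ℝ) : ℂ) • hermiteVec p.1 p.2

theorem orthonormal_hermiteUnit : Orthonormal ℂ hermiteUnit := by
  refine ⟨fun p => ?_, fun p q hpq => ?_⟩
  · have h := norm_ne_zero_iff.2 (hermiteVec_ne_zero p.1 p.2)
    rw [hermiteUnit, norm_smul, Complex.norm_real, norm_inv, norm_norm, inv_mul_cancel₀ h]
  · change inner ℂ (hermiteUnit p) (hermiteUnit q) = 0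
    simp only [hermiteUnit]
    rw [inner_smul_left, inner_smul_right, inner_hermiteVec_hermiteVec,
      if_neg, mul_zero, mul_zero]
    exact fun h => hpq (Prod.ext h.1 h.2)

/-- The Hilbert basis of normalized Ito-Hermite polynomials. -/
noncomputable def hermiteBasis : HilbertBasis (ℕ × ℕ) ℂ GaussL2 :=
  HilbertBasis.mkOfOrthogonalEqBot orthonormal_hermiteUnit <| by
    refine (Submodule.eq_bot_iff _).2 fun f hf => eq_zero_of_inner_hermiteVec_eq_zero fun m n => ?_
    have h := (Submodule.mem_orthogonal _ _).1 hf (hermiteUnit (m, n))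
      (Submodule.subset_span ⟨(m, n), rfl⟩)
    rw [hermiteUnit, inner_smul_left, mul_eq_zero] at h
    refine h.resolve_left ?_
    simp [hermiteVec_ne_zero]

theorem hasSum_hermiteUnit (f : GaussL2) :
    HasSum (fun p => inner ℂ (hermiteUnit p) f • hermiteUnit p) f := by
  have h := hermiteBasis.hasSum_repr f
  have e : ∀ p, hermiteBasis p = hermiteUnit p := fun p => by
    rw [hermiteBasis, HilbertBasis.coe_mkOfOrthogonalEqBot]
  simpa only [hermiteBasis.repr_apply_apply, e] using h

theorem summable_smul_hermiteVec_iff (l : ℕ) (a : ℕ → ℂ) :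
    Summable (fun m => a m • hermiteVec m l) ↔
      Summable fun m => (m.factorial : ℝ) * ‖a m‖ ^ 2 := by
  have ho : Orthonormal ℂ fun m => hermiteUnit (m, l) :=
    orthonormal_hermiteUnit.comp _ fun m m' h => (Prod.ext_iff.1 h).1
  have h := ho.orthogonalFamily.summable_iff_norm_sq_summable
    (fun m => (‖hermiteVec m l‖ : ℂ) * a m)
  have e1 : ∀ m, ((‖hermiteVec m l‖ : ℂ) * a m) • hermiteUnit (m, l) = a m • hermiteVec m l := by
    intro m
    have h0 : (‖hermiteVec m l‖ : ℂ) ≠ 0 := by simp [hermiteVec_ne_zero]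
    rw [hermiteUnit, smul_smul]
    congr 1
    push_cast
    field_simp
  have e2 : ∀ m, ‖(‖hermiteVec m l‖ : ℂ) * a m‖ ^ 2 =
      (Real.pi * l.factorial) * ((m.factorial : ℝ) * ‖a m‖ ^ 2) := by
    intro m
    rw [norm_mul, mul_pow, Complex.norm_real, norm_norm, norm_hermiteVec_sq]
    ring
  simp only [LinearIsometry.toSpanSingleton_apply, e1, e2] at h
  rw [h]
  have : Real.pi * l.factorial ≠ 0 :=
    mul_ne_zero Real.pi_ne_zero (Nat.cast_ne_zero.2 l.factorial_ne_zero)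
  exact summable_mul_left_iff this

/-- The eigenspace `A²_l` consists of the convergent series in `H_{m,l}`, `m = 0, 1, …`. -/
theorem mem_bargmann_iff {l : ℕ} {f : GaussL2} :
    f ∈ bargmann l ↔ ∃ a : ℕ → ℂ, HasSum (fun m => a m • hermiteVec m l) f := by
  constructor
  · intro hf
    refine ⟨fun m => inner ℂ (hermiteUnit (m, l)) f * ((‖hermiteVec m l‖⁻¹ : ℝ) : ℂ), ?_⟩
    have hinj : Function.Injective fun m : ℕ => (m, l) := fun m m' h => (Prod.ext_iff.1 h).1
    have h := (hinj.hasSum_iff (f := fun p => inner ℂ (hermiteUnit p) f • hermiteUnit p)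
      (a := f) ?_).2 (hasSum_hermiteUnit f)
    · simpa only [Function.comp_def, hermiteUnit, smul_smul] using h
    · rintro ⟨m, k⟩ hk
      have hkl : k ≠ l := fun h => hk ⟨m, by rw [h]⟩
      rw [hermiteUnit, inner_smul_left, inner_hermiteVec_eq_zero_of_mem_bargmann hf m hkl,
        mul_zero, zero_smul]
  · rintro ⟨a, ha⟩
    exact (bargmann_isClosed l).mem_of_tendsto ha (Filter.Eventually.of_forall fun s =>
      Submodule.sum_mem _ fun m _ => Submodule.smul_mem _ _ (hermiteVec_mem_bargmann m l))

/-! ### The operator `P_n C` on Ito-Hermite polynomials -/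

/-- The composition `P_n C` as a bounded operator. -/
noncomputable def projCauchy (n : ℕ) : GaussL2 →L[ℂ] GaussL2 :=
  ⟨(bargmannProj n).toLinearMap ∘ₗ cauchyTransform,
    (bargmannProj n).continuous.comp continuous_cauchyTransform⟩

/-- An element of `A²_n` is determined by its inner products with the `H_{k,n}`. -/
theorem projCauchy_eq_of_inner {n : ℕ} {f g : GaussL2} (hg : g ∈ bargmann n)
    (h : ∀ k, inner ℂ (hermiteVec k n) (cauchyTransform f) = inner ℂ (hermiteVec k n) g) :
    projCauchy n f = g := by
  refine Submodule.eq_starProjection_of_mem_of_inner_eq_zero hg fun w hw => ?_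
  obtain ⟨a, ha⟩ := mem_bargmann_iff.1 hw
  rw [← inner_conj_symm, map_eq_zero]
  have h1 := (innerSL ℂ (cauchyTransform f - g)).hasSum ha
  simp only [innerSL_apply_apply, inner_smul_right] at h1
  have h2 : ∀ k, inner ℂ (cauchyTransform f - g) (hermiteVec k n) = 0 := by
    intro k
    rw [← inner_conj_symm, inner_sub_right, h, sub_self, map_zero]
  simp only [h2, mul_zero] at h1
  rw [← inner_conj_symm, h1.unique hasSum_zero, map_zero]

theorem projCauchy_hermiteVec_of_lt {m l n : ℕ} (h : m + n < l + 1) :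
    projCauchy n (hermiteVec m l) = 0 := by
  refine projCauchy_eq_of_inner (bargmann n).zero_mem fun k => ?_
  rw [inner_hermiteVec_cauchyTransform, if_neg (by omega), inner_zero_right]

/-- The factor of the matrix coefficients of `P_n C` on `A²_l` which depends only on `l` and `n`. -/
noncomputable def projCauchyConst (l n : ℕ) : ℂ := (-1) ^ (l + n + 1) / (2 ^ n * n.factorial)

theorem projCauchyConst_ne_zero (l n : ℕ) : projCauchyConst l n ≠ 0 := by
  have : (n.factorial : ℂ) ≠ 0 := Nat.cast_ne_zero.2 n.factorial_ne_zero
  simp [projCauchyConst, this]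

/-- The factor of the matrix coefficient of `P_n C` at `H_{j,l}` which depends on `j`. Its
value is meaningful for `l + 1 ≤ n + j`, where the subtractions do not truncate. -/
noncomputable def projCauchyCoeff (l n j : ℕ) : ℂ :=
  (n + j - 1).factorial / (2 ^ j * (n + j - l - 1).factorial)

theorem projCauchyCoeff_ne_zero (l n j : ℕ) : projCauchyCoeff l n j ≠ 0 := by
  have h : ∀ k : ℕ, (k.factorial : ℂ) ≠ 0 := fun k => Nat.cast_ne_zero.2 k.factorial_ne_zero
  simp [projCauchyCoeff, h]

theorem projCauchy_hermiteVec {j l n : ℕ} (h : l + 1 ≤ n + j) :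
    projCauchy n (hermiteVec j l) =
      (projCauchyCoeff l n j * projCauchyConst l n) • hermiteVec (n + j - l - 1) n := by
  obtain ⟨k, hk⟩ : ∃ k, n + j = l + k + 1 := ⟨n + j - l - 1, by omega⟩
  have hk1 : n + j - l - 1 = k := by omega
  have hk2 : n + j - 1 = l + k := by omega
  refine projCauchy_eq_of_inner
    (Submodule.smul_mem _ _ (hermiteVec_mem_bargmann _ n)) fun k' => ?_
  rw [inner_hermiteVec_cauchyTransform, inner_smul_right, inner_hermiteVec_hermiteVec, hk1]
  by_cases hkk : k' = k
  · subst hkk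
    rw [if_pos (by omega), if_pos ⟨rfl, rfl⟩, projCauchyCoeff, projCauchyConst, hk1, hk2]
    have hf : ∀ k : ℕ, (k.factorial : ℂ) ≠ 0 := fun k => Nat.cast_ne_zero.2 k.factorial_ne_zero
    have hpow : (2 : ℂ) ^ j * 2 ^ n = 2 ^ (l + k') * 2 := by
      rw [← pow_add, ← pow_succ, add_comm j n, hk]
    have hsgn : (-1 : ℂ) ^ (j + l) * (-1) ^ (l + k') = (-1) ^ (l + n + 1) := by
      rw [← pow_add]
      refine neg_one_pow_congr ?_
      simp only [Nat.even_iff]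
      omega
    have h1 := hf k'
    have h2 := hf n
    calc (-1 : ℂ) ^ (j + l) * (-1 / 2) ^ (l + k') * (l + k').factorial * (Real.pi / 2)
        = ((-1) ^ (j + l) * (-1) ^ (l + k')) * (l + k').factorial * Real.pi /
            (2 ^ (l + k') * 2) := by
          rw [div_pow]; field_simp
      _ = _ := by
          rw [hsgn, ← hpow]; field_simp
  · rw [if_neg (by omega), if_neg (fun h => hkk h.1), mul_zero]

theorem linearIndependent_hermiteVec (n : ℕ) : LinearIndependent ℂ fun k => hermiteVec k n :=
  linearIndependent_of_ne_zero_of_inner_eq_zero (fun k => hermiteVec_ne_zero k n)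
    fun k k' h => by
      simp only
      rw [inner_hermiteVec_hermiteVec, if_neg fun h1 => h h1.1]

/-! ### The ranges -/

theorem mem_cauchyRange {l n : ℕ} {u : GaussL2} :
    u ∈ cauchyRange l n ↔ ∃ f ∈ bargmann l, projCauchy n f = u := Submodule.mem_map

theorem hermiteVec_mem_cauchyRange {l n j : ℕ} (h : l + 1 - n ≤ j) :
    hermiteVec (n + j - l - 1) n ∈ cauchyRange l n := by
  have h0 := mul_ne_zero (projCauchyCoeff_ne_zero l n j) (projCauchyConst_ne_zero l n)
  refine mem_cauchyRange.2 ⟨(projCauchyCoeff l n j * projCauchyConst l n)⁻¹ • hermiteVec j l,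
    Submodule.smul_mem _ _ (hermiteVec_mem_bargmann j l), ?_⟩
  rw [map_smul, projCauchy_hermiteVec (by omega), smul_smul, inv_mul_cancel₀ h0, one_smul]

/-- Termwise application of `P_n C`; the terms with `n + j < l + 1` are zero and are dropped. -/
theorem hasSum_projCauchy {l n : ℕ} {a : ℕ → ℂ} {f : GaussL2}
    (ha : HasSum (fun m => a m • hermiteVec m l) f) :
    HasSum (fun j : {j : ℕ // l + 1 - n ≤ j} =>
      (projCauchyCoeff l n j * (projCauchyConst l n * a j)) • hermiteVec (n + j - l - 1) n)
      (projCauchy n f) := by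
  have h1 := (projCauchy n).hasSum ha
  simp only [map_smul] at h1
  have h2 := (hasSum_subtype_iff_of_support_subset (s := {j : ℕ | l + 1 - n ≤ j}) ?_).2 h1
  · refine h2.congr_fun fun j => ?_
    have hj : l + 1 - n ≤ (j : ℕ) := j.2
    simp only [Function.comp_apply]
    rw [projCauchy_hermiteVec (by omega), smul_smul]
    congr 1
    ring
  · intro j hj
    by_contra hlt
    have hlt' : ¬ l + 1 - n ≤ j := hlt
    refine hj ?_
    simp only
    rw [projCauchy_hermiteVec_of_lt (by omega), smul_zero]

theorem mem_cauchyRange_iff {l n : ℕ} {u : GaussL2} : u ∈ cauchyRange l n ↔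
    ∃ α : ℕ → ℂ, Summable (fun j => (j.factorial : ℝ) * ‖α j‖ ^ 2) ∧
      HasSum (fun j : {j : ℕ // l + 1 - n ≤ j} =>
        (projCauchyCoeff l n j * α j) • hermiteVec (n + j - l - 1) n) u := by
  rw [mem_cauchyRange]
  constructor
  · rintro ⟨f, hf, rfl⟩
    obtain ⟨a, ha⟩ := mem_bargmann_iff.1 hf
    refine ⟨fun j => projCauchyConst l n * a j, ?_, hasSum_projCauchy ha⟩
    refine (((summable_smul_hermiteVec_iff l a).1 ha.summable).mul_left
      (‖projCauchyConst l n‖ ^ 2)).congr fun j => ?_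
    rw [norm_mul]
    ring
  · rintro ⟨α, hα, hu⟩
    have hs : Summable fun j => ((projCauchyConst l n)⁻¹ * α j) • hermiteVec j l := by
      refine (summable_smul_hermiteVec_iff l _).2
        ((hα.mul_left (‖(projCauchyConst l n)⁻¹‖ ^ 2)).congr fun j => ?_)
      rw [norm_mul]
      ring
    obtain ⟨f, hf⟩ := hs
    refine ⟨f, mem_bargmann_iff.2 ⟨_, hf⟩, ?_⟩
    have h1 := hasSum_projCauchy (n := n) hf
    simp only [mul_inv_cancel_left₀ (projCauchyConst_ne_zero l n)] at h1
    exact h1.unique hu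

theorem not_finiteDimensional_cauchyRange (l n : ℕ) : ¬ FiniteDimensional ℂ (cauchyRange l n) := by
  intro hfin
  let v : ℕ → cauchyRange l n := fun i => ⟨hermiteVec (n + (l + 1 + i) - l - 1) n,
    hermiteVec_mem_cauchyRange (by omega)⟩
  have hv : LinearIndependent ℂ v := by
    refine LinearIndependent.of_comp (cauchyRange l n).subtype ?_
    refine (linearIndependent_hermiteVec n).comp (fun i => n + (l + 1 + i) - l - 1) fun i i' h => ?_
    simp only at h
    omega
  exact Module.Finite.not_linearIndependent_of_infinite v hv

theorem topologicalClosure_cauchyRange (l n : ℕ) : (cauchyRange l n).topologicalClosure =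
    (Submodule.span ℂ ((fun j : ℕ => hermiteVec (n + j - l - 1) n) ''
      {j | l + 1 - n ≤ j})).topologicalClosure := by
  refine le_antisymm (Submodule.topologicalClosure_minimal _ (fun u hu => ?_)
    (Submodule.isClosed_topologicalClosure _)) (Submodule.topologicalClosure_mono ?_)
  · obtain ⟨α, -, hα⟩ := mem_cauchyRange_iff.1 hu
    exact mem_closure_of_tendsto hα (Filter.Eventually.of_forall fun s =>
      Submodule.sum_mem _ fun j _ => Submodule.smul_mem _ _ (Submodule.subset_span ⟨j, j.2, rfl⟩))
  · rw [Submodule.span_le]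
    rintro _ ⟨j, hj, rfl⟩
    exact hermiteVec_mem_cauchyRange hj

/-- The preimage under `P_n C` of the finite-dimensional span is closed and contains all `H_{l,b}`, hence
their closed span; conversely `H_{k,n}` is a multiple of the image of `H_{l,n+l-1-k}`. -/
theorem cauchyRangeTilde_eq_span (l n : ℕ) : cauchyRangeTilde l n =
    Submodule.span ℂ (Set.range fun k : Fin (n + l) => hermiteVec k n) := by
  set W := Submodule.span ℂ (Set.range fun k : Fin (n + l) => hermiteVec k n)
  have hfin : FiniteDimensional ℂ W := FiniteDimensional.span_of_finite ℂ (Set.finite_range _)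
  refine le_antisymm (Submodule.map_le_iff_le_comap.2 ?_) ?_
  · refine Submodule.topologicalClosure_minimal _ ?_
      (W.closed_of_finiteDimensional.preimage (projCauchy n).continuous)
    rw [Submodule.span_le]
    rintro _ ⟨b, rfl⟩
    change projCauchy n (hermiteVec l b) ∈ W
    rcases lt_or_ge (l + n) (b + 1) with h | h
    · rw [projCauchy_hermiteVec_of_lt h]
      exact W.zero_mem
    · rw [projCauchy_hermiteVec (by omega)]
      exact W.smul_mem _ (Submodule.subset_span ⟨⟨n + l - b - 1, by omega⟩, rfl⟩)
  · rw [Submodule.span_le]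
    rintro _ ⟨⟨k, hk⟩, rfl⟩
    have h0 := mul_ne_zero (projCauchyCoeff_ne_zero (n + l - k - 1) n l)
      (projCauchyConst_ne_zero (n + l - k - 1) n)
    refine ⟨(projCauchyCoeff (n + l - k - 1) n l * projCauchyConst (n + l - k - 1) n)⁻¹ •
      hermiteVec l (n + l - k - 1), Submodule.smul_mem _ _
        (Submodule.le_topologicalClosure _ (Submodule.subset_span ⟨_, rfl⟩)), ?_⟩
    change projCauchy n _ = _
    rw [map_smul, projCauchy_hermiteVec (by omega), smul_smul, inv_mul_cancel₀ h0, one_smul,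
      show n + l - (n + l - k - 1) - 1 = k by omega]

end WeightedCauchy

theorem mainTheorem2 :
    (∀ l n : ℕ,
      ¬ FiniteDimensional ℂ (cauchyRange l n) ∧
      Submodule.span ℂ ((fun j : ℕ => hermiteVec (n + j - l - 1) n) '' {j | l + 1 - n ≤ j}) ≤
        cauchyRange l n ∧
      (cauchyRange l n).topologicalClosure =
        (Submodule.span ℂ ((fun j : ℕ => hermiteVec (n + j - l - 1) n) ''
          {j | l + 1 - n ≤ j})).topologicalClosure ∧
      ∀ u : GaussL2, u ∈ cauchyRange l n ↔
        ∃ α : ℕ → ℂ, Summable (fun j => (j.factorial : ℝ) * ‖α j‖ ^ 2) ∧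
          HasSum (fun j : {j : ℕ // l + 1 - n ≤ j} =>
            (((n + j - 1).factorial : ℂ) / (2 ^ (j : ℕ) * ((n + j - l - 1).factorial : ℂ)) * α j) •
              hermiteVec (n + j - l - 1) n) u) ∧
    cauchyRangeTilde 0 0 = ⊥ ∧
    (∀ l n : ℕ, 0 < l + n →
      FiniteDimensional ℂ (cauchyRangeTilde l n) ∧
      Module.finrank ℂ (cauchyRangeTilde l n) = n + l ∧
      (∀ k k' : Fin (n + l), k ≠ k' → inner ℂ (hermiteVec k n) (hermiteVec k' n) = 0) ∧
      LinearIndependent ℂ (fun k : Fin (n + l) => hermiteVec k n) ∧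
      Submodule.span ℂ (Set.range fun k : Fin (n + l) => hermiteVec k n) =
        cauchyRangeTilde l n) := by
  
  refine ⟨fun l n => ⟨not_finiteDimensional_cauchyRange l n, ?_, topologicalClosure_cauchyRange l n,
    fun u => mem_cauchyRange_iff⟩, ?_, fun l n _ => ?_⟩
  · rw [Submodule.span_le]
    rintro _ ⟨j, hj, rfl⟩
    exact hermiteVec_mem_cauchyRange hj
  · rw [cauchyRangeTilde_eq_span, Submodule.span_eq_bot]
    rintro _ ⟨k, rfl⟩
    exact k.elim0
  · have hli : LinearIndependent ℂ fun k : Fin (n + l) => hermiteVec k n :=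
      (linearIndependent_hermiteVec n).comp _ Fin.val_injective
    rw [cauchyRangeTilde_eq_span]
    refine ⟨FiniteDimensional.span_of_finite ℂ (Set.finite_range _), ?_, fun k k' h => ?_, hli, rfl⟩
    · rw [finrank_span_eq_card hli, Fintype.card_fin]
    · rw [inner_hermiteVec_hermiteVec, if_neg fun h1 => h (Fin.ext h1.1)]
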